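/- Let $p$ be a probability distribution on an input space $U$, let $X=\{X_1,\dots,X_K\}$ be real readout functions on $U$ and $y$ a real target function on $U$, with $E[\,\cdot\,]$ denoting expectation under $p$. Assume that $E[|X_i|^5]<\infty$ for all $i$, $E[|y|^5]<\infty$ and $E[y^2]>0$. Define the capacity $$C(y,X)=1-\frac{\min_{W\in\mathbb R^K}E\big[(\sum_i W_iX_i-y)^2\big]}{E[y^2]} .$$ Let $u(1),u(2),\dots$ be i.i.d. samples from $p$. From the first $N$ of them form $(G_N)_{ij}=\frac1N\sum_{n=1}^N X_i(u(n))X_j(u(n))$ and $(R_N)_i=\frac1N\sum_{n=1}^N X_i(u(n))\,y(u(n))$, and let $$C_N(y,X)=\frac{R_N^{T}G_N^{+}R_N}{E[y^2]}$$ be the empirical capacity, where $E[y^2]$ is taken to be known exactly and $G_N^{+}$ is the Moore–Penrose pseudo-inverse ($G_N^{+}=G_N^{-1}$ when $G_N$ is invertible). Let $\mathcal X=\mathrm{span}\{X_1,\dots,X_K\}\subset L^2(p)$, let $P^\perp_{\mathcal X}$ be the orthogonal projector of $L^2(p)$ onto the orthogonal complement of $\mathcal X$, and let $\tilde X_1,\dots,\tilde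 X_d$ be any orthonormal basis of $\mathcal X$ (so $d=K$ when the Gram matrix $(E[X_iX_j])_{ij}$ is invertible). Put $$\Delta(y,X)=\frac{E\Big[\big(\sum_{i=1}^d\tilde X_i^2\big)\,\big(P^\perp_{\mathcal X}y\big)^2\Big]}{E[y^2]} .$$ Then $C_N(y,X)$ is integrable for every $N$, the expectation defining $\Delta(y,X)$ is finite, $\Delta(y,X)\ge 0$, and, as $N\to\infty$ with $p$, $X$ and $y$ fixed, the expectation of $C_N(y,X)$ over datasets satisfies $$E\big[C_N(y,X)\big]=C(y,X)+\frac{\Delta(y,X)}{N}+\mathcal O\big(N^{-3/2}\big).$$ -/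

import Mathlib

open MeasureTheory ProbabilityTheory Filter
open scoped Matrix

namespace IPC

/-! ## Moore–Penrose pseudo-inverse of a real square matrix -/

/-- `B` is the Moore–Penrose pseudo-inverse of `A`. -/
structure IsMoorePenrose {n : Type*} [Fintype n] (A B : Matrix n n ℝ) : Prop where
  mul_mul_left : A * B * A = A
  mul_mul_right : B * A * B = B
  isSymm_left : (A * B)ᵀ = A * B
  isSymm_right : (B * A)ᵀ = B * A

theorem IsMoorePenrose.unique {n : Type*} [Fintype n] {A B C : Matrix n n ℝ}
    (hB : IsMoorePenrose A B) (hC : IsMoorePenrose A C) : B = C := by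
  have h1 : A * B = A * C := by
    calc A * B = (A * B)ᵀ := hB.isSymm_left.symm
      _ = (A * C * (A * B))ᵀ := by rw [← mul_assoc (A * C) A B, hC.mul_mul_left]
      _ = A * B * (A * C) := by rw [Matrix.transpose_mul, hB.isSymm_left, hC.isSymm_left]
      _ = A * C := by rw [← mul_assoc (A * B) A C, hB.mul_mul_left]
  have h2 : B * A = C * A := by
    calc B * A = (B * A)ᵀ := hB.isSymm_right.symm
      _ = (B * A * (C * A))ᵀ := by rw [mul_assoc B A (C * A), ← mul_assoc A C A, hC.mul_mul_left]
      _ = C * A * (B * A) := by rw [Matrix.transpose_mul, hB.isSymm_right, hC.isSymm_right]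
      _ = C * A := by rw [mul_assoc C A (B * A), ← mul_assoc A B A, hB.mul_mul_left]
  calc B = B * A * B := hB.mul_mul_right.symm
    _ = C * A * C := by rw [h2, mul_assoc, h1, ← mul_assoc]
    _ = C := hC.mul_mul_right

theorem exists_isMoorePenrose {n : Type*} [Fintype n] {A : Matrix n n ℝ} (hA : Aᵀ = A) :
    ∃ B, IsMoorePenrose A B := by
  classical
  have hH : A.IsHermitian := by
    rw [Matrix.IsHermitian, Matrix.conjTranspose_eq_transpose_of_trivial, hA]
  obtain ⟨V, d, hV, hAV⟩ : ∃ (V : Matrix n n ℝ) (d : n → ℝ),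
      Vᵀ * V = 1 ∧ A = V * Matrix.diagonal d * Vᵀ := by
    refine ⟨hH.eigenvectorUnitary, hH.eigenvalues, ?_, ?_⟩
    · have := Unitary.coe_star_mul_self hH.eigenvectorUnitary
      rwa [Matrix.star_eq_conjTranspose, Matrix.conjTranspose_eq_transpose_of_trivial] at this
    · have := hH.spectral_theorem
      rw [Unitary.conjStarAlgAut_apply, Matrix.star_eq_conjTranspose,
        Matrix.conjTranspose_eq_transpose_of_trivial] at this
      exact this
  have key : ∀ a b : n → ℝ, V * Matrix.diagonal a * Vᵀ * (V * Matrix.diagonal b * Vᵀ)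
      = V * Matrix.diagonal (fun i => a i * b i) * Vᵀ := by
    intro a b
    calc _ = V * Matrix.diagonal a * (Vᵀ * V) * Matrix.diagonal b * Vᵀ := by
          simp only [mul_assoc]
      _ = _ := by rw [hV, mul_one, mul_assoc V, Matrix.diagonal_mul_diagonal]
  have hT : ∀ a : n → ℝ, (V * Matrix.diagonal a * Vᵀ)ᵀ = V * Matrix.diagonal a * Vᵀ := by
    intro a
    simp [Matrix.transpose_mul, mul_assoc]
  refine ⟨V * Matrix.diagonal (fun i => (d i)⁻¹) * Vᵀ, ?_, ?_, ?_, ?_⟩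
  · rw [hAV, key, key]
    congr 3; ext i; exact mul_inv_mul_cancel (d i)
  · rw [hAV, key, key]
    congr 3; ext i; simpa using mul_inv_mul_cancel (d i)⁻¹
  · rw [hAV, key, hT]
  · rw [hAV, key, hT]

open Classical in
/-- The Moore–Penrose pseudo-inverse (it is used here for symmetric matrices only). -/
noncomputable def pinv {n : Type*} [Fintype n] (A : Matrix n n ℝ) : Matrix n n ℝ :=
  if h : ∃ B, IsMoorePenrose A B then h.choose else 0

theorem isMoorePenrose_pinv {n : Type*} [Fintype n] {A : Matrix n n ℝ} (hA : Aᵀ = A) :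
    IsMoorePenrose A (pinv A) := by
  have h := exists_isMoorePenrose hA
  rw [pinv, dif_pos h]
  exact h.choose_spec

/-! ## Capacity with respect to the input distribution -/

section Population

variable {U : Type*} [MeasurableSpace U] {K : ℕ}

/-- Gram matrix `G i j = E[X i * X j]`. -/
noncomputable def gram (p : Measure U) (X : Fin K → U → ℝ) : Matrix (Fin K) (Fin K) ℝ :=
  Matrix.of fun i j => ∫ v, X i v * X j v ∂p

/-- Correlation vector `R i = E[X i * y]`. -/
noncomputable def corr (p : Measure U) (X : Fin K → U → ℝ) (y : U → ℝ) : Fin K → ℝ :=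
  fun i => ∫ v, X i v * y v ∂p

/-- Mean squared error `E[(∑ i, W i * X i - y)^2]` of the output with weights `W`. -/
noncomputable def mse (p : Measure U) (X : Fin K → U → ℝ) (y : U → ℝ) (W : Fin K → ℝ) : ℝ :=
  ∫ v, (∑ i, W i * X i v - y v) ^ 2 ∂p

/-- The capacity `1 - MSE⋆ / E[y^2]`, where `MSE⋆` is the smallest mean squared error. -/
noncomputable def capacity (p : Measure U) (X : Fin K → U → ℝ) (y : U → ℝ) : ℝ :=
  1 - (⨅ W : Fin K → ℝ, mse p X y W) / ∫ v, y v ^ 2 ∂p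

/-- The span of the readouts, as a subspace of `L²(p)`. -/
noncomputable def readoutSpace (p : Measure U) (X : Fin K → U → ℝ) (hX : ∀ i, MemLp (X i) 2 p) :
    Submodule ℝ (Lp ℝ 2 p) :=
  Submodule.span ℝ (Set.range fun i => (hX i).toLp (X i))

instance (p : Measure U) (X : Fin K → U → ℝ) (hX : ∀ i, MemLp (X i) 2 p) :
    FiniteDimensional ℝ (readoutSpace p X hX) :=
  FiniteDimensional.span_of_finite ℝ (Set.finite_range _)

/-- The component of `y` orthogonal to the span of the readouts, in `L²(p)`. -/
noncomputable def orthComponent (p : Measure U) (X : Fin K → U → ℝ) (y : U → ℝ)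
    (hX : ∀ i, MemLp (X i) 2 p) (hy : MemLp y 2 p) : Lp ℝ 2 p :=
  (readoutSpace p X hX)ᗮ.starProjection (hy.toLp y)

/-- The integrand `(∑ i, X̃ i ^ 2) * (P⊥ y) ^ 2`, where `X̃` is an orthonormal basis of the span of
the readouts. -/
noncomputable def biasIntegrand (p : Measure U) (X : Fin K → U → ℝ) (y : U → ℝ)
    (hX : ∀ i, MemLp (X i) 2 p) (hy : MemLp y 2 p) {ι : Type*} [Fintype ι]
    (Xt : OrthonormalBasis ι ℝ (readoutSpace p X hX)) (v : U) : ℝ :=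
  (∑ i, ((Xt i : Lp ℝ 2 p) : U → ℝ) v ^ 2) * (orthComponent p X y hX hy : U → ℝ) v ^ 2

/-- The coefficient `Δ(y, X)` of the `1 / N` bias. -/
noncomputable def biasCoeff (p : Measure U) (X : Fin K → U → ℝ) (y : U → ℝ)
    (hX : ∀ i, MemLp (X i) 2 p) (hy : MemLp y 2 p) {ι : Type*} [Fintype ι]
    (Xt : OrthonormalBasis ι ℝ (readoutSpace p X hX)) : ℝ :=
  (∫ v, biasIntegrand p X y hX hy Xt v ∂p) / ∫ v, y v ^ 2 ∂p

end Population

/-! ## Capacity estimated from `N` samples -/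

section Empirical

variable {U : Type*} [MeasurableSpace U] {K N : ℕ}

/-- Empirical Gram matrix of the samples `s 0, …, s (N - 1)`. -/
noncomputable def empGram (X : Fin K → U → ℝ) (s : Fin N → U) : Matrix (Fin K) (Fin K) ℝ :=
  Matrix.of fun i j => (N : ℝ)⁻¹ * ∑ n, X i (s n) * X j (s n)

/-- Empirical correlation vector. -/
noncomputable def empCorr (X : Fin K → U → ℝ) (y : U → ℝ) (s : Fin N → U) : Fin K → ℝ :=
  fun i => (N : ℝ)⁻¹ * ∑ n, X i (s n) * y (s n)

/-- Empirical capacity `R_Nᵀ G_N⁺ R_N / E[y^2]`; the normalization `E[y^2]` is the exact one. -/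
noncomputable def empCapacity (p : Measure U) (X : Fin K → U → ℝ) (y : U → ℝ)
    (s : Fin N → U) : ℝ :=
  (empCorr X y s ⬝ᵥ (pinv (empGram X s) *ᵥ empCorr X y s)) / ∫ v, y v ^ 2 ∂p

end Empirical

end IPC

/-! Choose an orthonormal basis `x` of the span of the readouts and write `y = c·x + z` with `z`
orthogonal to the span. The quantity `Rᵀ G⁺ R` is the squared empirical norm of the least-squares
fit, so it depends only on the span of the readouts on the sample. In the new coordinates
(`exists_empGram_mulVec_eq_of_basis_change`) it equals the sample mean of `(c·x)² + 2 (c·x) z`,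
whose expectation is exactly `∑ c_j² = C E[y²]`, plus `r·v`, where `r` is the empirical correlation
of `x` with `z` and `G v = r` for the empirical Gram matrix `G` of `x`. The whole bias is thus
`E[r·v]`: the apparent capacity gained by fitting the noise `z`.

With `E = G - 1`, expanding the inverse gives `r·v = r·r - r·E r + (E v)·(E r)`. The entries of `r`
and `E` are deviations of empirical averages of products. The first term has mean `E[(∑ x_i²) z²] /
N`, the announced coefficient; the second is a third moment of averages, and the remainder is
controlled by fourth moments of averages (`abs_dotProduct_sub_quadratic_le`).

Fifth moments of `x` and `z` do not bound these third and fourth moments, which involve sixth and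
eighth moments of the data. All products are therefore set to zero where an envelope `M` exceeds
`√N`. With `m = E[M⁵]`, truncation makes everything bounded, and each error is then at most a
constant times `N^(-3/2)`: `N⁻³ · N · √N` for the third moments, `N⁻⁴ · (N · N^(3/2) + N²)` for the
fourth, `N · m / N^(5/2)` for the probability that some sample is truncated, and `m / N^(3/2)` for
the bias of a truncated mean. When some sample is truncated or `G` is far from `1`, the a priori
bound `0 ≤ r·v ≤ (1/N) ∑ z²` replaces the expansion
(`abs_empCorr_dotProduct_sub_truncQuadratic_le`). -/

namespace IPC

/-! ## Moments of sums of independent bounded random variables -/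

section BoundedMoments

/-- Almost everywhere measurable and uniformly bounded real functions. -/
structure BddAEMeasurable {Ω : Type*} [MeasurableSpace Ω] (f : Ω → ℝ) (P : Measure Ω) : Prop where
  aemeasurable : AEMeasurable f P
  bound : ∃ B, ∀ ω, |f ω| ≤ B

namespace BddAEMeasurable

variable {Ω : Type*} [MeasurableSpace Ω] {P : Measure Ω} {f g : Ω → ℝ}

theorem integrable [IsFiniteMeasure P] (hf : BddAEMeasurable f P) : Integrable f P := by
  obtain ⟨B, hB⟩ := hf.bound
  exact Integrable.of_bound hf.aemeasurable.aestronglyMeasurable B (Eventually.of_forall hB)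

theorem const (c : ℝ) : BddAEMeasurable (fun _ : Ω => c) P :=
  ⟨aemeasurable_const, |c|, fun _ => le_rfl⟩

theorem add (hf : BddAEMeasurable f P) (hg : BddAEMeasurable g P) :
    BddAEMeasurable (fun ω => f ω + g ω) P := by
  obtain ⟨A, hA⟩ := hf.bound
  obtain ⟨B, hB⟩ := hg.bound
  exact ⟨hf.aemeasurable.add hg.aemeasurable, A + B,
    fun ω => (abs_add_le _ _).trans (add_le_add (hA ω) (hB ω))⟩

theorem mul (hf : BddAEMeasurable f P) (hg : BddAEMeasurable g P) :
    BddAEMeasurable (fun ω => f ω * g ω) P := by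
  obtain ⟨A, hA⟩ := hf.bound
  obtain ⟨B, hB⟩ := hg.bound
  refine ⟨hf.aemeasurable.mul hg.aemeasurable, A * B, fun ω => ?_⟩
  rw [abs_mul]
  exact mul_le_mul (hA ω) (hB ω) (abs_nonneg _) ((abs_nonneg _).trans (hA ω))

theorem sub (hf : BddAEMeasurable f P) (hg : BddAEMeasurable g P) :
    BddAEMeasurable (fun ω => f ω - g ω) P := by
  simpa [sub_eq_add_neg] using hf.add ((const (-1)).mul hg)

theorem pow (hf : BddAEMeasurable f P) (k : ℕ) : BddAEMeasurable (fun ω => f ω ^ k) P := by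
  induction k with
  | zero => simpa using const 1
  | succ k ih => simpa [pow_succ] using ih.mul hf

theorem sum {κ : Type*} (s : Finset κ) {f : κ → Ω → ℝ} (hf : ∀ i, BddAEMeasurable (f i) P) :
    BddAEMeasurable (fun ω => ∑ i ∈ s, f i ω) P := by
  classical
  induction s using Finset.induction_on with
  | empty => simpa using const 0
  | insert a s ha ih => simpa [Finset.sum_insert ha] using (hf a).add ih

end BddAEMeasurable

theorem BddAEMeasurable.comp_hasLaw {Ω U : Type*} [MeasurableSpace Ω] [MeasurableSpace U]
    {P : Measure Ω} {p : Measure U} {f : U → ℝ} {u : Ω → U} (hf : BddAEMeasurable f p)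
    (hu : HasLaw u p P) : BddAEMeasurable (fun ω => f (u ω)) P := by
  obtain ⟨B, hB⟩ := hf.bound
  exact ⟨(hu.map_eq ▸ hf.aemeasurable).comp_aemeasurable hu.aemeasurable, B, fun ω => hB _⟩

/-- The sum of `f` over the first `N` samples. -/
def sampleSum {U Ω : Type*} (u : ℕ → Ω → U) (f : U → ℝ) (N : ℕ) (ω : Ω) : ℝ :=
  ∑ n ∈ Finset.range N, f (u n ω)

theorem sampleSum_succ {U Ω : Type*} {u : ℕ → Ω → U} (f : U → ℝ) (N : ℕ) (ω : Ω) :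
    sampleSum u f (N + 1) ω = sampleSum u f N ω + f (u N ω) :=
  Finset.sum_range_succ _ _

variable {U Ω : Type*} [MeasurableSpace U] [MeasurableSpace Ω]
  {p : Measure U} {P : Measure Ω} {u : ℕ → Ω → U}

theorem BddAEMeasurable.sampleSum {f : U → ℝ} (hf : BddAEMeasurable f p)
    (hu : ∀ n, HasLaw (u n) p P) (N : ℕ) : BddAEMeasurable (IPC.sampleSum u f N) P :=
  BddAEMeasurable.sum _ fun n => hf.comp_hasLaw (hu n)

/-- Joint independence of the whole vector of partial sums from the next sample is what lets
products of several different sums be integrated by induction on `N`. -/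
theorem indepFun_sampleSum [IsProbabilityMeasure P] (hu : ∀ n, HasLaw (u n) p P)
    (hind : iIndepFun u P) {κ : Type*} {f : κ → U → ℝ}
    (hf : ∀ k, Measurable (f k)) (N : ℕ) :
    IndepFun (fun ω k => sampleSum u (f k) N ω) (u N) P := by
  have h := hind.indepFun_finset₀ (Finset.range N) {N} (by simp) (fun n => (hu n).aemeasurable)
  have h1 : Measurable (fun (t : (Finset.range N) → U) (k : κ) => ∑ n, f k (t n)) := by
    refine measurable_pi_lambda _ fun k => Finset.measurable_sum _ fun n _ => ?_
    exact (hf k).comp (measurable_pi_apply n)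
  have h2 : Measurable (fun t : ({N} : Finset ℕ) → U => t ⟨N, by simp⟩) := measurable_pi_apply _
  have := h.comp h1 h2
  convert! this using 1
  · ext ω k
    simp only [sampleSum, Function.comp]
    rw [← Finset.sum_coe_sort]

theorem integral_mul_comp_of_indepFun [IsProbabilityMeasure P] {v : Ω → U} (hv : HasLaw v p P)
    {κ : Type*} {S : Ω → κ → ℝ} (hS : IndepFun S v P) {F : (κ → ℝ) → ℝ} (hF : Measurable F)
    (hFS : AEMeasurable (fun ω => F (S ω)) P) {g : U → ℝ} (hg : Measurable g) :
    ∫ ω, F (S ω) * g (v ω) ∂P = (∫ ω, F (S ω) ∂P) * ∫ a, g a ∂p := by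
  have h := (hS.comp hF hg).integral_fun_mul_eq_mul_integral hFS.aestronglyMeasurable
    (hg.comp_aemeasurable hv.aemeasurable).aestronglyMeasurable
  simp only [Function.comp] at h
  rw [h]
  congr 1
  exact hv.integral_comp hg.aestronglyMeasurable

theorem integral_sampleSum (hu : ∀ n, HasLaw (u n) p P) {f : U → ℝ} (hf : Integrable f p)
    (N : ℕ) : ∫ ω, sampleSum u f N ω ∂P = N * ∫ v, f v ∂p := by
  have hi : ∀ n, Integrable (fun ω => f (u n ω)) P := fun n => by
    have := (hu n).map_eq ▸ hf
    exact this.comp_aemeasurable (hu n).aemeasurable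
  have he : ∀ n, ∫ ω, f (u n ω) ∂P = ∫ v, f v ∂p :=
    fun n => (hu n).integral_comp hf.aestronglyMeasurable
  simp [sampleSum, integral_finsetSum _ fun n _ => hi n, he]

theorem integrable_sampleSum (hu : ∀ n, HasLaw (u n) p P) {f : U → ℝ} (hf : Integrable f p)
    (N : ℕ) : Integrable (sampleSum u f N) P := by
  refine integrable_finsetSum _ fun n _ => ?_
  have := (hu n).map_eq ▸ hf
  exact this.comp_aemeasurable (hu n).aemeasurable

variable [IsProbabilityMeasure P]

theorem integral_sampleSum_mul (hu : ∀ n, HasLaw (u n) p P) (hind : iIndepFun u P)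
    {f : Fin 2 → U → ℝ} (hfm : ∀ i, Measurable (f i)) (hf : ∀ i, BddAEMeasurable (f i) p)
    (h0 : ∀ i, ∫ v, f i v ∂p = 0) (N : ℕ) :
    ∫ ω, sampleSum u (f 0) N ω * sampleSum u (f 1) N ω ∂P = N * ∫ v, f 0 v * f 1 v ∂p := by
  induction N with
  | zero => simp [sampleSum]
  | succ N ih =>
    have hS := indepFun_sampleSum hu hind hfm N
    have bS := fun i => (hf i).sampleSum hu N
    have bf := fun i => (hf i).comp_hasLaw (hu N)
    have e1 := integral_mul_comp_of_indepFun (hu N) hS (F := fun s => s 0) (by fun_prop)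
      (bS 0).aemeasurable (hfm 1)
    have e2 := integral_mul_comp_of_indepFun (hu N) hS (F := fun s => s 1) (by fun_prop)
      (bS 1).aemeasurable (hfm 0)
    have e3 : ∫ ω, f 0 (u N ω) * f 1 (u N ω) ∂P = ∫ v, f 0 v * f 1 v ∂p :=
      (hu N).integral_comp ((hfm 0).mul (hfm 1)).aestronglyMeasurable
    have hexp : ∀ ω, sampleSum u (f 0) (N + 1) ω * sampleSum u (f 1) (N + 1) ω
        = sampleSum u (f 0) N ω * sampleSum u (f 1) N ω + sampleSum u (f 0) N ω * f 1 (u N ω)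
          + sampleSum u (f 1) N ω * f 0 (u N ω) + f 0 (u N ω) * f 1 (u N ω) := fun ω => by
      simp only [sampleSum_succ]; ring
    simp_rw [hexp]
    have i1 := ((bS 0).mul (bS 1))
    have i2 := (bS 0).mul (bf 1)
    have i3 := (bS 1).mul (bf 0)
    have i4 := (bf 0).mul (bf 1)
    rw [integral_add ((i1.add i2).add i3).integrable i4.integrable,
      integral_add (i1.add i2).integrable i3.integrable,
      integral_add i1.integrable i2.integrable, ih, e1, e2, e3, h0, h0]
    push_cast
    ring

/-- In a product of three centred sums, any term that is not fully diagonal contains a sample index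
occurring exactly once, hence has mean zero. The growth is therefore linear in `N`. -/
theorem integral_sampleSum_mul_mul [IsProbabilityMeasure p] (hu : ∀ n, HasLaw (u n) p P) (hind : iIndepFun u P)
    {f : Fin 3 → U → ℝ} (hfm : ∀ i, Measurable (f i)) (hf : ∀ i, BddAEMeasurable (f i) p)
    (h0 : ∀ i, ∫ v, f i v ∂p = 0) (N : ℕ) :
    ∫ ω, sampleSum u (f 0) N ω * sampleSum u (f 1) N ω * sampleSum u (f 2) N ω ∂P
      = N * ∫ v, f 0 v * f 1 v * f 2 v ∂p := by
  induction N with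
  | zero => simp [sampleSum]
  | succ N ih =>
    have hS := indepFun_sampleSum hu hind hfm N
    have bS := fun i => (hf i).sampleSum hu N
    have bf := fun i => (hf i).comp_hasLaw (hu N)
    have hz : ∀ i, ∫ ω, sampleSum u (f i) N ω ∂P = 0 := fun i => by
      rw [integral_sampleSum hu (hf i).integrable, h0, mul_zero]
    have e2 : ∀ i j k, ∫ ω, sampleSum u (f i) N ω * sampleSum u (f j) N ω * f k (u N ω) ∂P = 0 := by
      intro i j k
      have := integral_mul_comp_of_indepFun (hu N) hS (F := fun s => s i * s j) (by fun_prop)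
        ((bS i).mul (bS j)).aemeasurable (hfm k)
      rw [this, h0, mul_zero]
    have e1 : ∀ i j k, ∫ ω, sampleSum u (f i) N ω * (f j (u N ω) * f k (u N ω)) ∂P = 0 := by
      intro i j k
      have := integral_mul_comp_of_indepFun (hu N) hS (F := fun s => s i) (by fun_prop)
        (bS i).aemeasurable ((hfm j).mul (hfm k))
      rw [hz, zero_mul] at this
      exact this
    have e3 : ∫ ω, f 0 (u N ω) * f 1 (u N ω) * f 2 (u N ω) ∂P = ∫ v, f 0 v * f 1 v * f 2 v ∂p :=
      (hu N).integral_comp (((hfm 0).mul (hfm 1)).mul (hfm 2)).aestronglyMeasurable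
    have hexp : ∀ ω, sampleSum u (f 0) (N + 1) ω * sampleSum u (f 1) (N + 1) ω
          * sampleSum u (f 2) (N + 1) ω
        = sampleSum u (f 0) N ω * sampleSum u (f 1) N ω * sampleSum u (f 2) N ω
          + (sampleSum u (f 0) N ω * sampleSum u (f 1) N ω * f 2 (u N ω)
          + (sampleSum u (f 0) N ω * sampleSum u (f 2) N ω * f 1 (u N ω)
          + (sampleSum u (f 1) N ω * sampleSum u (f 2) N ω * f 0 (u N ω)
          + (sampleSum u (f 0) N ω * (f 1 (u N ω) * f 2 (u N ω))
          + (sampleSum u (f 1) N ω * (f 0 (u N ω) * f 2 (u N ω))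
          + (sampleSum u (f 2) N ω * (f 0 (u N ω) * f 1 (u N ω))
          + f 0 (u N ω) * f 1 (u N ω) * f 2 (u N ω))))))) := fun ω => by
      simp only [sampleSum_succ]; ring
    simp_rw [hexp]
    have i0 := ((bS 0).mul (bS 1)).mul (bS 2)
    have i1 := ((bS 0).mul (bS 1)).mul (bf 2)
    have i2 := ((bS 0).mul (bS 2)).mul (bf 1)
    have i3 := ((bS 1).mul (bS 2)).mul (bf 0)
    have i4 := (bS 0).mul ((bf 1).mul (bf 2))
    have i5 := (bS 1).mul ((bf 0).mul (bf 2))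
    have i6 := (bS 2).mul ((bf 0).mul (bf 1))
    have i7 := ((bf 0).mul (bf 1)).mul (bf 2)
    have j6 := i6.add i7
    have j5 := i5.add j6
    have j4 := i4.add j5
    have j3 := i3.add j4
    have j2 := i2.add j3
    have j1 := i1.add j2
    rw [integral_add i0.integrable j1.integrable, integral_add i1.integrable j2.integrable,
      integral_add i2.integrable j3.integrable, integral_add i3.integrable j4.integrable,
      integral_add i4.integrable j5.integrable, integral_add i5.integrable j6.integrable,
      integral_add i6.integrable i7.integrable, ih, e2, e2, e2, e1, e1, e1, e3]
    push_cast
    ring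

theorem integral_sampleSum_pow_four_le [IsProbabilityMeasure p] (hu : ∀ n, HasLaw (u n) p P) (hind : iIndepFun u P)
    {f : U → ℝ} (hfm : Measurable f) (hf : BddAEMeasurable f p) (h0 : ∫ v, f v ∂p = 0) (N : ℕ) :
    ∫ ω, sampleSum u f N ω ^ 4 ∂P ≤ N * ∫ v, f v ^ 4 ∂p + 3 * (N * ∫ v, f v ^ 2 ∂p) ^ 2 := by
  induction N with
  | zero => simp [sampleSum]
  | succ N ih =>
    have hS := indepFun_sampleSum (κ := Unit) (f := fun _ => f) hu hind (fun _ => hfm) N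
    have bS := hf.sampleSum hu N
    have bf := hf.comp_hasLaw (hu N)
    have hz : ∫ ω, sampleSum u f N ω ∂P = 0 := by
      rw [integral_sampleSum hu hf.integrable, h0, mul_zero]
    have hsq : ∫ ω, sampleSum u f N ω ^ 2 ∂P = N * ∫ v, f v ^ 2 ∂p := by
      have := integral_sampleSum_mul hu hind (f := fun _ => f) (fun _ => hfm) (fun _ => hf)
        (fun _ => h0) N
      simpa [pow_two] using this
    have e : ∀ k l, ∫ ω, sampleSum u f N ω ^ k * f (u N ω) ^ l ∂P
        = (∫ ω, sampleSum u f N ω ^ k ∂P) * ∫ v, f v ^ l ∂p := fun k l =>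
      integral_mul_comp_of_indepFun (hu N) hS (F := fun s => s () ^ k) (by fun_prop)
        (bS.pow k).aemeasurable (hfm.pow_const l)
    have e4 : ∫ ω, f (u N ω) ^ 4 ∂P = ∫ v, f v ^ 4 ∂p :=
      (hu N).integral_comp (hfm.pow_const 4).aestronglyMeasurable
    have hexp : ∀ ω, sampleSum u f (N + 1) ω ^ 4
        = sampleSum u f N ω ^ 4 + (4 * (sampleSum u f N ω ^ 3 * f (u N ω) ^ 1)
          + (6 * (sampleSum u f N ω ^ 2 * f (u N ω) ^ 2)
          + (4 * (sampleSum u f N ω ^ 1 * f (u N ω) ^ 3) + f (u N ω) ^ 4))) := fun ω => by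
      simp only [sampleSum_succ]; ring
    simp_rw [hexp]
    have c : ∀ a : ℝ, BddAEMeasurable (fun _ : Ω => a) P := BddAEMeasurable.const
    have i0 := bS.pow 4
    have i1 := (c 4).mul ((bS.pow 3).mul (bf.pow 1))
    have i2 := (c 6).mul ((bS.pow 2).mul (bf.pow 2))
    have i3 := (c 4).mul ((bS.pow 1).mul (bf.pow 3))
    have i4 := bf.pow 4
    have j3 := i3.add i4
    have j2 := i2.add j3
    have j1 := i1.add j2
    rw [integral_add i0.integrable j1.integrable, integral_add i1.integrable j2.integrable,
      integral_add i2.integrable j3.integrable, integral_add i3.integrable i4.integrable,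
      integral_const_mul, integral_const_mul, integral_const_mul, e, e, e, e4, hsq]
    simp only [pow_one, h0, hz]
    push_cast
    -- With `w = ∫ f²`, the surviving cross term `6 N w²` is below the increment `(6 N + 3) w²` of
    -- `3 (N w)²`.
    nlinarith [sq_nonneg (∫ v, f v ^ 2 ∂p)]

end BoundedMoments

/-! ## Truncated empirical averages -/

section Truncation

/-- A measurable function `M ≥ 1` with finite fifth moment, used to truncate samples. -/
structure IsEnvelope {U : Type*} [MeasurableSpace U] (M : U → ℝ) (p : Measure U) : Prop where
  measurable : Measurable M
  one_le : ∀ v, 1 ≤ M v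
  integrable_pow : Integrable (fun v => M v ^ 5) p

/-- The function `f` set to zero where `M` exceeds the level `s`. -/
noncomputable def trunc {U : Type*} (M : U → ℝ) (s : ℝ) (f : U → ℝ) (v : U) : ℝ :=
  if M v ≤ s then f v else 0

/-- Deviation of the empirical average of the truncation of `f` at level `√N` from the mean of
`f`. -/
noncomputable def truncDev {U Ω : Type*} [MeasurableSpace U] (p : Measure U) (M : U → ℝ)
    (u : ℕ → Ω → U) (f : U → ℝ) (N : ℕ) (ω : Ω) : ℝ :=
  (N : ℝ)⁻¹ * sampleSum u (trunc M √N f) N ω - ∫ v, f v ∂p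

theorem trunc_pow {U : Type*} {M : U → ℝ} {s : ℝ} (f : U → ℝ) {k : ℕ} (hk : k ≠ 0) (v : U) :
    trunc M s f v ^ k = trunc M s (fun v => f v ^ k) v := by
  simp only [trunc]; split_ifs <;> simp [hk]

theorem abs_sq_le_pow_four {U : Type*} {M f : U → ℝ} (hfM : ∀ v, |f v| ≤ M v ^ 2) (v : U) : |f v ^ 2| ≤ M v ^ 4 := by
  rw [abs_pow]
  calc |f v| ^ 2 ≤ (M v ^ 2) ^ 2 := pow_le_pow_left₀ (abs_nonneg _) (hfM v) 2
    _ = M v ^ 4 := by ring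

variable {U : Type*} [MeasurableSpace U] {p : Measure U} {M : U → ℝ} {s : ℝ}

theorem measurable_trunc (hM : Measurable M) {f : U → ℝ} (hf : Measurable f) :
    Measurable (trunc M s f) :=
  Measurable.ite (measurableSet_le hM measurable_const) hf measurable_const

namespace IsEnvelope

theorem pos (hM : IsEnvelope M p) (v : U) : 0 < M v := zero_lt_one.trans_le (hM.one_le v)

theorem integrable_of_le (hM : IsEnvelope M p) {f : U → ℝ} (hf : AEStronglyMeasurable f p)
    {k : ℕ} (hk : k ≤ 5) (hfM : ∀ v, |f v| ≤ M v ^ k) : Integrable f p :=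
  hM.integrable_pow.mono' hf (Eventually.of_forall fun v =>
    (hfM v).trans (pow_le_pow_right₀ (hM.one_le v) hk))

theorem one_le_moment [IsProbabilityMeasure p] (hM : IsEnvelope M p) :
    1 ≤ ∫ v, M v ^ 5 ∂p := by
  have := integral_mono (integrable_const (1 : ℝ)) hM.integrable_pow
    (fun v => one_le_pow₀ (hM.one_le v))
  simpa using this

theorem bdd_trunc (hM : IsEnvelope M p) {f : U → ℝ} (hf : Measurable f) {k : ℕ}
    (hfM : ∀ v, |f v| ≤ M v ^ k) : BddAEMeasurable (trunc M s f) p := by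
  refine ⟨(measurable_trunc hM.measurable hf).aemeasurable, |s| ^ k, fun v => ?_⟩
  rw [trunc]
  split_ifs with h
  · exact (hfM v).trans (pow_le_pow_left₀ (hM.pos v).le (h.trans (le_abs_self s)) k)
  · simp

/-- A Markov bound: where `M > s`, one has `M ^ k ≤ s⁻¹ ^ (5 - k) * M ^ 5`. The cases used are `k =
0` (probability of truncation), `k = 2` (bias of a mean) and `k = 4` (bias of a second moment). -/
theorem integral_abs_sub_trunc_le (hM : IsEnvelope M p) (hs : 1 ≤ s) {f : U → ℝ} {k : ℕ}
    (hk : k ≤ 5) (hfM : ∀ v, |f v| ≤ M v ^ k) :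
    ∫ v, |f v - trunc M s f v| ∂p ≤ (s⁻¹) ^ (5 - k) * ∫ v, M v ^ 5 ∂p := by
  rw [← integral_const_mul]
  refine integral_mono_of_nonneg (Eventually.of_forall fun v => abs_nonneg _)
    (hM.integrable_pow.const_mul _) (Eventually.of_forall fun v => ?_)
  have hp := hM.pos v
  simp only [trunc]
  split_ifs with h
  · simp only [sub_self, abs_zero]; positivity
  · rw [sub_zero, inv_pow, inv_mul_eq_div, le_div_iff₀ (by positivity)]
    calc |f v| * s ^ (5 - k) ≤ M v ^ k * M v ^ (5 - k) := by
          gcongr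
          · exact hfM v
          · exact (not_le.mp h).le
      _ = M v ^ 5 := by rw [← pow_add, Nat.add_sub_cancel' hk]

theorem abs_integral_trunc_sub_le (hM : IsEnvelope M p) [IsProbabilityMeasure p]
    (hs : 1 ≤ s) {f : U → ℝ} (hf : Measurable f) {k : ℕ}
    (hk : k ≤ 5) (hfM : ∀ v, |f v| ≤ M v ^ k) :
    |∫ v, trunc M s f v ∂p - ∫ v, f v ∂p| ≤ (s⁻¹) ^ (5 - k) * ∫ v, M v ^ 5 ∂p := by
  rw [abs_sub_comm, ← integral_sub (hM.integrable_of_le hf.aestronglyMeasurable hk hfM)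
    (hM.bdd_trunc hf hfM).integrable]
  exact (abs_integral_le_integral_abs).trans (hM.integral_abs_sub_trunc_le hs hk hfM)

/-- Each power of `M` beyond the fifth costs one factor `s`. The subtraction `k - 5` is that of `ℕ`,
so for `k ≤ 5` the bound is just the fifth moment. -/
theorem integral_trunc_le (hM : IsEnvelope M p) [IsProbabilityMeasure p] (hs : 1 ≤ s) {f : U → ℝ}
    (hf : Measurable f) {k : ℕ} (hfM : ∀ v, |f v| ≤ M v ^ k) :
    ∫ v, trunc M s f v ∂p ≤ s ^ (k - 5) * ∫ v, M v ^ 5 ∂p := by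
  rw [← integral_const_mul]
  refine integral_mono (hM.bdd_trunc hf hfM).integrable (hM.integrable_pow.const_mul _) fun v => ?_
  have hp := hM.pos v
  simp only [trunc]
  split_ifs with h
  · calc f v ≤ M v ^ k := (le_abs_self _).trans (hfM v)
      _ ≤ M v ^ ((k - 5) + 5) := pow_le_pow_right₀ (hM.one_le v) (by omega)
      _ = M v ^ (k - 5) * M v ^ 5 := pow_add _ _ _
      _ ≤ s ^ (k - 5) * M v ^ 5 := by gcongr
  · positivity

theorem abs_integral_trunc_le (hM : IsEnvelope M p) [IsProbabilityMeasure p] (hs : 1 ≤ s)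
    {f : U → ℝ} (hf : Measurable f) {k : ℕ} (hfM : ∀ v, |f v| ≤ M v ^ k) :
    |∫ v, trunc M s f v ∂p| ≤ s ^ (k - 5) * ∫ v, M v ^ 5 ∂p := by
  refine abs_le'.2 ⟨hM.integral_trunc_le hs hf hfM, ?_⟩
  rw [← integral_neg]
  have := hM.integral_trunc_le hs (f := fun v => - f v) hf.neg (k := k) (by simpa using hfM)
  have e : ∀ v, - trunc M s f v = trunc M s (fun v => - f v) v := fun v => by
    simp only [trunc]; split_ifs <;> simp
  simpa only [e] using this

end IsEnvelope

/-- The truncation of `f` minus its mean. -/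
noncomputable def truncCentered (p : Measure U) (M : U → ℝ) (s : ℝ) (f : U → ℝ) (v : U) : ℝ :=
  trunc M s f v - ∫ v, trunc M s f v ∂p

namespace IsEnvelope

variable {f : U → ℝ}

theorem measurable_truncCentered (hM : IsEnvelope M p) (hf : Measurable f) :
    Measurable (truncCentered p M s f) :=
  (measurable_trunc hM.measurable hf).sub_const _

theorem bdd_truncCentered (hM : IsEnvelope M p) (hf : Measurable f)
    (hfM : ∀ v, |f v| ≤ M v ^ 2) : BddAEMeasurable (truncCentered p M s f) p :=
  (hM.bdd_trunc hf hfM).sub (BddAEMeasurable.const _)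

variable [IsProbabilityMeasure p]

theorem integral_truncCentered (hM : IsEnvelope M p) (hf : Measurable f)
    (hfM : ∀ v, |f v| ≤ M v ^ 2) : ∫ v, truncCentered p M s f v ∂p = 0 := by
  simp [truncCentered, integral_sub (hM.bdd_trunc hf hfM).integrable (integrable_const _)]

theorem integral_truncCentered_sq (hM : IsEnvelope M p) (hf : Measurable f)
    (hfM : ∀ v, |f v| ≤ M v ^ 2) :
    ∫ v, truncCentered p M s f v ^ 2 ∂p
      = ∫ v, trunc M s (fun v => f v ^ 2) v ∂p - (∫ v, trunc M s f v ∂p) ^ 2 := by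
  have hb := hM.bdd_trunc (s := s) hf hfM
  set a := ∫ v, trunc M s f v ∂p with ha
  have : ∀ v, truncCentered p M s f v ^ 2
      = trunc M s (fun v => f v ^ 2) v - (2 * a * trunc M s f v - a ^ 2) := fun v => by
    rw [← trunc_pow f two_ne_zero, truncCentered, ← ha]; ring
  simp_rw [this]
  rw [integral_sub, integral_sub, integral_const_mul, ← ha]
  · simp; ring
  · exact hb.integrable.const_mul _
  · exact integrable_const _
  · exact (hb.pow 2).integrable.congr (Eventually.of_forall fun v => trunc_pow f two_ne_zero v)
  · exact (hb.integrable.const_mul _).sub (integrable_const _)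

theorem integral_truncCentered_sq_le (hM : IsEnvelope M p) (hs : 1 ≤ s) (hf : Measurable f)
    (hfM : ∀ v, |f v| ≤ M v ^ 2) :
    ∫ v, truncCentered p M s f v ^ 2 ∂p ≤ ∫ v, M v ^ 5 ∂p := by
  rw [hM.integral_truncCentered_sq hf hfM]
  have := hM.integral_trunc_le hs (hf.pow_const 2) (k := 4) (abs_sq_le_pow_four hfM)
  simp only [Nat.reduceLeDiff, Nat.sub_eq_zero_of_le, pow_zero, one_mul] at this
  nlinarith [sq_nonneg (∫ v, trunc M s f v ∂p)]

theorem abs_truncCentered_le (hM : IsEnvelope M p) (hs : 1 ≤ s) (hf : Measurable f)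
    (hfM : ∀ v, |f v| ≤ M v ^ 2) (v : U) :
    |truncCentered p M s f v| ≤ trunc M s (fun v => M v ^ 2) v + ∫ v, M v ^ 5 ∂p := by
  refine (abs_sub _ _).trans (add_le_add ?_ ?_)
  · simp only [trunc]
    split_ifs
    · exact hfM v
    · simp
  · simpa using hM.abs_integral_trunc_le hs hf hfM

/-- Since `f` is a product of two data functions, this is an eighth moment of the envelope, three
powers too many: hence `s ^ 3`. -/
theorem integral_truncCentered_pow_four_le (hM : IsEnvelope M p) (hs : 1 ≤ s) (hf : Measurable f)
    (hfM : ∀ v, |f v| ≤ M v ^ 2) :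
    ∫ v, truncCentered p M s f v ^ 4 ∂p ≤ 16 * s ^ 3 * (∫ v, M v ^ 5 ∂p) ^ 4 := by
  set m := ∫ v, M v ^ 5 ∂p with hm
  have hm1 : 1 ≤ m := hM.one_le_moment
  have hM2 : Measurable fun v => M v ^ 2 := hM.measurable.pow_const 2
  have hM2' : ∀ v, |M v ^ 2| ≤ M v ^ 2 := fun v => (abs_of_nonneg (sq_nonneg _)).le
  have hb := hM.bdd_trunc (s := s) hM2 hM2'
  calc ∫ v, truncCentered p M s f v ^ 4 ∂p
      ≤ ∫ v, 8 * (trunc M s (fun v => M v ^ 2) v ^ 4 + m ^ 4) ∂p := by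
        refine integral_mono ((hM.bdd_truncCentered hf hfM).pow 4).integrable
          (((hb.pow 4).add (BddAEMeasurable.const _)).integrable.const_mul _) fun v => ?_
        have h1 := hM.abs_truncCentered_le hs hf hfM v
        simp only
        calc truncCentered p M s f v ^ 4 = |truncCentered p M s f v| ^ 4 :=
              ((by decide : Even 4).pow_abs _).symm
          _ ≤ (trunc M s (fun v => M v ^ 2) v + m) ^ 4 := pow_le_pow_left₀ (abs_nonneg _) h1 4
          _ ≤ 8 * (trunc M s (fun v => M v ^ 2) v ^ 4 + m ^ 4) := by
            have := add_pow_le (a := trunc M s (fun v => M v ^ 2) v) (b := m)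
              (by simp only [trunc]; split_ifs <;> positivity) (by positivity) 4
            norm_num at this; exact this
    _ = 8 * (∫ v, trunc M s (fun v => (M v ^ 2) ^ 4) v ∂p + m ^ 4) := by
        rw [integral_const_mul, integral_add (hb.pow 4).integrable (integrable_const _)]
        simp_rw [trunc_pow (fun v => M v ^ 2) (by norm_num : 4 ≠ 0)]
        simp
    _ ≤ 8 * (s ^ 3 * m + m ^ 4) := by
        gcongr
        exact hM.integral_trunc_le hs (hM2.pow_const 4) (k := 8) (fun v => by
          rw [← pow_mul, abs_of_nonneg (pow_nonneg (hM.pos v).le _)])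
    _ ≤ 16 * s ^ 3 * m ^ 4 := by
        have a1 : m ≤ m ^ 4 := le_self_pow₀ hm1 (by norm_num)
        have a2 : 1 ≤ s ^ 3 := one_le_pow₀ hs
        nlinarith [mul_le_mul_of_nonneg_left a1 (by positivity : 0 ≤ s ^ 3),
          mul_le_mul_of_nonneg_right a2 (by positivity : 0 ≤ m ^ 4)]

/-- A sixth moment of the envelope, one power too many: hence the single factor `s`. -/
theorem abs_integral_truncCentered_mul_mul_le (hM : IsEnvelope M p) (hs : 1 ≤ s)
    {f : Fin 3 → U → ℝ} (hf : ∀ i, Measurable (f i)) (hfM : ∀ i v, |f i v| ≤ M v ^ 2) :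
    |∫ v, truncCentered p M s (f 0) v * truncCentered p M s (f 1) v * truncCentered p M s (f 2) v ∂p|
      ≤ 8 * s * (∫ v, M v ^ 5 ∂p) ^ 3 := by
  set m := ∫ v, M v ^ 5 ∂p with hm
  have hm1 : 1 ≤ m := hM.one_le_moment
  have hM2 : Measurable fun v => M v ^ 2 := hM.measurable.pow_const 2
  have hM2' : ∀ v, |M v ^ 2| ≤ M v ^ 2 := fun v => (abs_of_nonneg (sq_nonneg _)).le
  have hb := hM.bdd_trunc (s := s) hM2 hM2'
  have ht : ∀ v, 0 ≤ trunc M s (fun v => M v ^ 2) v := fun v => by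
    simp only [trunc]; split_ifs <;> positivity
  calc _ ≤ ∫ v, |truncCentered p M s (f 0) v * truncCentered p M s (f 1) v
          * truncCentered p M s (f 2) v| ∂p := abs_integral_le_integral_abs
    _ ≤ ∫ v, 4 * (trunc M s (fun v => M v ^ 2) v ^ 3 + m ^ 3) ∂p := by
        refine integral_mono_of_nonneg (Eventually.of_forall fun v => abs_nonneg _)
          (((hb.pow 3).add (BddAEMeasurable.const _)).integrable.const_mul _)
          (Eventually.of_forall fun v => ?_)
        have h1 := fun i => hM.abs_truncCentered_le hs (hf i) (hfM i) v
        have hmt := add_nonneg (ht v) (zero_le_one.trans hm1)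
        simp only [abs_mul]
        calc _ ≤ (trunc M s (fun v => M v ^ 2) v + m) * (trunc M s (fun v => M v ^ 2) v + m)
              * (trunc M s (fun v => M v ^ 2) v + m) := by
              gcongr
              exacts [h1 0, h1 1, h1 2]
          _ = (trunc M s (fun v => M v ^ 2) v + m) ^ 3 := by ring
          _ ≤ 4 * (trunc M s (fun v => M v ^ 2) v ^ 3 + m ^ 3) := by
            have := add_pow_le (ht v) (zero_le_one.trans hm1) 3
            norm_num at this; exact this
    _ = 4 * (∫ v, trunc M s (fun v => (M v ^ 2) ^ 3) v ∂p + m ^ 3) := by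
        rw [integral_const_mul, integral_add (hb.pow 3).integrable (integrable_const _)]
        simp_rw [trunc_pow (fun v => M v ^ 2) (by norm_num : 3 ≠ 0)]
        simp
    _ ≤ 4 * (s ^ 1 * m + m ^ 3) := by
        gcongr
        exact hM.integral_trunc_le hs (hM2.pow_const 3) (k := 6) (fun v => by
          rw [← pow_mul, abs_of_nonneg (pow_nonneg (hM.pos v).le _)])
    _ ≤ 8 * s * m ^ 3 := by
        have a1 : m ≤ m ^ 3 := le_self_pow₀ hm1 (by norm_num)
        nlinarith [mul_le_mul_of_nonneg_left a1 (by positivity : 0 ≤ s),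
          mul_le_mul_of_nonneg_right hs (by positivity : 0 ≤ m ^ 3)]

theorem abs_integral_truncCentered_mul_le (hM : IsEnvelope M p) (hs : 1 ≤ s)
    {f g : U → ℝ} (hf : Measurable f) (hfM : ∀ v, |f v| ≤ M v ^ 2) (hg : Measurable g)
    (hgM : ∀ v, |g v| ≤ M v ^ 2) :
    |∫ v, truncCentered p M s f v * truncCentered p M s g v ∂p| ≤ ∫ v, M v ^ 5 ∂p := by
  have bf := (hM.bdd_truncCentered (s := s) hf hfM).pow 2
  have bg := (hM.bdd_truncCentered (s := s) hg hgM).pow 2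
  calc _ ≤ ∫ v, |truncCentered p M s f v * truncCentered p M s g v| ∂p :=
        abs_integral_le_integral_abs
    _ ≤ ∫ v, 2⁻¹ * (truncCentered p M s f v ^ 2 + truncCentered p M s g v ^ 2) ∂p := by
        refine integral_mono_of_nonneg (Eventually.of_forall fun v => abs_nonneg _)
          ((bf.add bg).integrable.const_mul _) (Eventually.of_forall fun v => ?_)
        simp only [abs_le]
        constructor
        · nlinarith [sq_nonneg (truncCentered p M s f v + truncCentered p M s g v)]
        · nlinarith [sq_nonneg (truncCentered p M s f v - truncCentered p M s g v)]
    _ ≤ _ := by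
        rw [integral_const_mul, integral_add bf.integrable bg.integrable]
        linarith [hM.integral_truncCentered_sq_le hs hf hfM,
          hM.integral_truncCentered_sq_le hs hg hgM]

end IsEnvelope

end Truncation

/-! ### Moments of truncated empirical deviations at level `√N` -/

section TruncatedDeviations

/-- The deviation is taken from the untruncated mean, so it is a centred average plus a
deterministic bias, which `abs_truncBias_le` shows to be of order `N^(-3/2)`. -/
theorem truncDev_eq {U Ω : Type*} [MeasurableSpace U] (p : Measure U) (M : U → ℝ) (u : ℕ → Ω → U) (f : U → ℝ) {N : ℕ} (hN : 1 ≤ N)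
    (ω : Ω) : truncDev p M u f N ω = (N : ℝ)⁻¹ * sampleSum u (truncCentered p M √N f) N ω
      + (∫ v, trunc M √N f v ∂p - ∫ v, f v ∂p) := by
  have : (N : ℝ) ≠ 0 := by positivity
  simp only [truncDev, sampleSum, truncCentered, Finset.sum_sub_distrib, Finset.sum_const,
    Finset.card_range, nsmul_eq_mul]
  field_simp
  ring

variable {U Ω : Type*} [MeasurableSpace U] [MeasurableSpace Ω]
  {p : Measure U} {P : Measure Ω} {u : ℕ → Ω → U} {M : U → ℝ}

theorem one_le_sqrt_natCast {N : ℕ} (hN : 1 ≤ N) : 1 ≤ √(N : ℝ) :=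
  Real.one_le_sqrt.2 (by exact_mod_cast hN)

theorem natCast_inv_eq (N : ℕ) : (N : ℝ)⁻¹ = (√(N : ℝ))⁻¹ ^ 2 := by
  rw [inv_pow, Real.sq_sqrt (Nat.cast_nonneg N)]

namespace IsEnvelope

theorem bdd_truncDev (hM : IsEnvelope M p) (hu : ∀ n, HasLaw (u n) p P) {f : U → ℝ}
    (hf : Measurable f) (hfM : ∀ v, |f v| ≤ M v ^ 2) (N : ℕ) :
    BddAEMeasurable (truncDev p M u f N) P :=
  ((BddAEMeasurable.const _).mul ((hM.bdd_trunc hf hfM).sampleSum hu N)).sub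
    (BddAEMeasurable.const _)

variable [IsProbabilityMeasure p] [IsProbabilityMeasure P]

theorem abs_truncBias_le (hM : IsEnvelope M p) {f : U → ℝ} (hf : Measurable f)
    (hfM : ∀ v, |f v| ≤ M v ^ 2) {N : ℕ} (hN : 1 ≤ N) :
    |∫ v, trunc M √N f v ∂p - ∫ v, f v ∂p| ≤ (√(N : ℝ))⁻¹ ^ 3 * ∫ v, M v ^ 5 ∂p :=
  hM.abs_integral_trunc_sub_le (one_le_sqrt_natCast hN) hf (by norm_num) hfM

/-- The diagonal part `N⁻⁴ · N · (√N)³` dominates the Gaussian part of order `N⁻²`. The constant is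
`160 = 8 (16 + 3 + 1)`: diagonal, Gaussian part and bias, with `8` from `(a + b)⁴ ≤ 8 (a⁴ + b⁴)`. -/
theorem integral_truncDev_pow_four_le (hM : IsEnvelope M p) (hu : ∀ n, HasLaw (u n) p P)
    (hind : iIndepFun u P) {f : U → ℝ} (hf : Measurable f) (hfM : ∀ v, |f v| ≤ M v ^ 2) {N : ℕ}
    (hN : 1 ≤ N) :
    ∫ ω, truncDev p M u f N ω ^ 4 ∂P ≤ 160 * (∫ v, M v ^ 5 ∂p) ^ 4 * (√(N : ℝ))⁻¹ ^ 3 := by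
  have hs := one_le_sqrt_natCast hN
  have h4 := hM.integral_truncCentered_pow_four_le hs hf hfM
  have h2 := hM.integral_truncCentered_sq_le hs hf hfM
  have hS := integral_sampleSum_pow_four_le hu hind
    (hM.measurable_truncCentered (s := √N) hf) (hM.bdd_truncCentered hf hfM)
    (hM.integral_truncCentered hf hfM) N
  have hb := hM.abs_truncBias_le hf hfM hN
  have bS := (hM.bdd_truncCentered (s := √N) hf hfM).sampleSum hu N
  have h20 : 0 ≤ ∫ v, truncCentered p M √N f v ^ 2 ∂p := integral_nonneg fun v => sq_nonneg _
  simp_rw [truncDev_eq p M u f hN]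
  set b := ∫ v, trunc M √N f v ∂p - ∫ v, f v ∂p
  set m := ∫ v, M v ^ 5 ∂p
  have hm1 : 1 ≤ m := hM.one_le_moment
  set t := (√(N : ℝ))⁻¹ with ht
  have ht0 : 0 < t := by positivity
  have ht1 : t ≤ 1 := inv_le_one_of_one_le₀ hs
  -- With `t = N^(-1/2)`, every power of `N` becomes an integer power of `t`, and the target order
  -- is `t ^ 3`.
  have hst : √(N : ℝ) = t⁻¹ := by simp [ht]
  have hNt : (N : ℝ) = t⁻¹ ^ 2 := by rw [← hst, Real.sq_sqrt (Nat.cast_nonneg N)]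
  have hNi : (N : ℝ)⁻¹ = t ^ 2 := natCast_inv_eq N
  have hb4 : b ^ 4 ≤ t ^ 3 * m ^ 4 := by
    calc b ^ 4 = |b| ^ 4 := ((by decide : Even 4).pow_abs _).symm
      _ ≤ (t ^ 3 * m) ^ 4 := pow_le_pow_left₀ (abs_nonneg _) hb 4
      _ = (t ^ 3) ^ 4 * m ^ 4 := mul_pow _ _ _
      _ ≤ t ^ 3 * m ^ 4 := by
        gcongr
        exact pow_le_of_le_one (pow_nonneg ht0.le 3) (pow_le_one₀ ht0.le ht1) (by norm_num)
  have hS' : (t ^ 2) ^ 4 * ∫ ω, sampleSum u (truncCentered p M √N f) N ω ^ 4 ∂P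
      ≤ 19 * t ^ 3 * m ^ 4 := by
    calc _ ≤ (t ^ 2) ^ 4 * (t⁻¹ ^ 2 * (16 * t⁻¹ ^ 3 * m ^ 4) + 3 * (t⁻¹ ^ 2 * m) ^ 2) := by
          refine mul_le_mul_of_nonneg_left (hS.trans ?_) (by positivity)
          rw [← hNt, ← hst]
          gcongr
      _ = 16 * t ^ 3 * m ^ 4 + 3 * (t ^ 3 * t) * m ^ 2 := by field_simp; try ring
      _ ≤ 16 * t ^ 3 * m ^ 4 + 3 * (t ^ 3 * 1) * m ^ 4 := by
          gcongr
          norm_num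
      _ = _ := by ring
  calc _ ≤ ∫ ω, 8 * ((t ^ 2) ^ 4 * sampleSum u (truncCentered p M √N f) N ω ^ 4 + b ^ 4) ∂P := by
        refine integral_mono
          (((((BddAEMeasurable.const _).mul bS).add (BddAEMeasurable.const _)).pow 4).integrable)
          (((BddAEMeasurable.const _).mul (((BddAEMeasurable.const _).mul (bS.pow 4)).add
            (BddAEMeasurable.const _))).integrable) fun ω => ?_
        simp only
        rw [hNi, ← mul_pow]
        nlinarith [sq_nonneg (t ^ 2 * sampleSum u (truncCentered p M √N f) N ω - b),
          sq_nonneg ((t ^ 2 * sampleSum u (truncCentered p M √N f) N ω) ^ 2 - b ^ 2),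
          add_sq_le (a := t ^ 2 * sampleSum u (truncCentered p M √N f) N ω) (b := b),
          add_sq_le (a := (t ^ 2 * sampleSum u (truncCentered p M √N f) N ω) ^ 2) (b := b ^ 2),
          pow_le_pow_left₀ (sq_nonneg _)
            (add_sq_le (a := t ^ 2 * sampleSum u (truncCentered p M √N f) N ω) (b := b)) 2]
    _ = 8 * ((t ^ 2) ^ 4 * ∫ ω, sampleSum u (truncCentered p M √N f) N ω ^ 4 ∂P + b ^ 4) := by
        rw [integral_const_mul, integral_add (((BddAEMeasurable.const _).mul (bS.pow 4)).integrable)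
          (integrable_const _), integral_const_mul]
        simp
    _ ≤ _ := by linarith

/-- The source of the `1 / N` term. Truncation changes the second moment of `f` by at most `N^(-1/2)
m`, a fourth-order quantity in the envelope, and the prefactor `1 / N` brings this to `N^(-3/2)`. -/
theorem abs_integral_truncDev_sq_sub_le (hM : IsEnvelope M p) (hu : ∀ n, HasLaw (u n) p P)
    (hind : iIndepFun u P) {f : U → ℝ} (hf : Measurable f) (hfM : ∀ v, |f v| ≤ M v ^ 2)
    (h0 : ∫ v, f v ∂p = 0) {N : ℕ} (hN : 1 ≤ N) :
    |∫ ω, truncDev p M u f N ω ^ 2 ∂P - (N : ℝ)⁻¹ * ∫ v, f v ^ 2 ∂p|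
      ≤ 2 * (∫ v, M v ^ 5 ∂p) ^ 2 * (√(N : ℝ))⁻¹ ^ 3 := by
  have hs := one_le_sqrt_natCast hN
  have hS := integral_sampleSum_mul hu hind (f := fun _ => truncCentered p M √N f)
    (fun _ => hM.measurable_truncCentered (s := √N) hf) (fun _ => hM.bdd_truncCentered hf hfM)
    (fun _ => hM.integral_truncCentered hf hfM) N
  have hS1 := integral_sampleSum hu (hM.bdd_truncCentered (s := √N) hf hfM).integrable N
  rw [hM.integral_truncCentered hf hfM, mul_zero] at hS1
  have hvar := hM.integral_truncCentered_sq (s := √N) hf hfM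
  have hb := hM.abs_truncBias_le hf hfM hN
  have hq := hM.abs_integral_trunc_sub_le hs (hf.pow_const 2) (k := 4) (by norm_num)
    (abs_sq_le_pow_four hfM)
  have bS := (hM.bdd_truncCentered (s := √N) hf hfM).sampleSum hu N
  simp_rw [← pow_two] at hS
  simp_rw [truncDev_eq p M u f hN]
  rw [h0, sub_zero] at hb ⊢
  rw [hvar] at hS
  set b := ∫ v, trunc M √N f v ∂p
  set q := ∫ v, trunc M √N (fun v => f v ^ 2) v ∂p
  set m := ∫ v, M v ^ 5 ∂p
  have hm1 : 1 ≤ m := hM.one_le_moment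
  set t := (√(N : ℝ))⁻¹ with ht
  have ht0 : 0 < t := by positivity
  have ht1 : t ≤ 1 := inv_le_one_of_one_le₀ hs
  have hNi : (N : ℝ)⁻¹ = t ^ 2 := natCast_inv_eq N
  have hNN : (t ^ 2) * N = 1 := by rw [← hNi]; exact inv_mul_cancel₀ (by positivity)
  rw [hNi]
  have hexp : ∫ ω, (t ^ 2 * sampleSum u (truncCentered p M √N f) N ω + b) ^ 2 ∂P
      = t ^ 2 * (q - b ^ 2) + b ^ 2 := by
    have : ∀ ω, (t ^ 2 * sampleSum u (truncCentered p M √N f) N ω + b) ^ 2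
        = (t ^ 2) ^ 2 * sampleSum u (truncCentered p M √N f) N ω ^ 2
          + ((2 * t ^ 2 * b) * sampleSum u (truncCentered p M √N f) N ω + b ^ 2) := fun ω => by ring
    simp_rw [this]
    have c : ∀ a : ℝ, BddAEMeasurable (fun _ : Ω => a) P := BddAEMeasurable.const
    rw [integral_add ((c _).mul (bS.pow 2)).integrable (((c _).mul bS).add (c _)).integrable,
      integral_add ((c _).mul bS).integrable (c _).integrable, integral_const_mul,
      integral_const_mul, hS, hS1]
    simp only [integral_const, probReal_univ, smul_eq_mul, mul_zero, one_mul, zero_add]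
    linear_combination t ^ 2 * (q - b ^ 2) * hNN
  rw [hexp]
  have e : t ^ 2 * (q - b ^ 2) + b ^ 2 - t ^ 2 * ∫ v, f v ^ 2 ∂p
      = t ^ 2 * (q - ∫ v, f v ^ 2 ∂p) + (1 - t ^ 2) * b ^ 2 := by ring
  rw [e]
  have hb2 : b ^ 2 ≤ t ^ 3 * m ^ 2 := by
    calc b ^ 2 = |b| ^ 2 := (sq_abs b).symm
      _ ≤ (t ^ 3 * m) ^ 2 := pow_le_pow_left₀ (abs_nonneg _) hb 2
      _ = (t ^ 3) ^ 2 * m ^ 2 := mul_pow _ _ _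
      _ ≤ t ^ 3 * m ^ 2 := by
        gcongr
        exact pow_le_of_le_one (pow_nonneg ht0.le 3) (pow_le_one₀ ht0.le ht1) (by norm_num)
  have ht2 : t ^ 2 ≤ 1 := pow_le_one₀ ht0.le ht1
  calc _ ≤ |t ^ 2 * (q - ∫ v, f v ^ 2 ∂p)| + |(1 - t ^ 2) * b ^ 2| := abs_add_le _ _
    _ ≤ t ^ 2 * (t ^ 1 * m) + 1 * (t ^ 3 * m ^ 2) := by
        rw [abs_mul, abs_mul, abs_of_nonneg (by positivity : 0 ≤ t ^ 2),
          abs_of_nonneg (by linarith : 0 ≤ 1 - t ^ 2), abs_of_nonneg (sq_nonneg b)]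
        gcongr
        linarith [sq_nonneg t]
    _ ≤ _ := by
        have : m ≤ m ^ 2 := le_self_pow₀ hm1 (by norm_num)
        nlinarith [mul_le_mul_of_nonneg_left this (by positivity : 0 ≤ t ^ 3)]

/-- The leading part is `N⁻³ · N · √N`. The constant `12` counts `8` for it and `1` for each of the
three variance-times-bias terms and for the product of the three biases; terms linear in a centred
sum vanish. -/
theorem abs_integral_truncDev_mul_mul_le (hM : IsEnvelope M p) (hu : ∀ n, HasLaw (u n) p P)
    (hind : iIndepFun u P) {f : Fin 3 → U → ℝ} (hf : ∀ i, Measurable (f i))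
    (hfM : ∀ i v, |f i v| ≤ M v ^ 2) {N : ℕ} (hN : 1 ≤ N) :
    |∫ ω, truncDev p M u (f 0) N ω * truncDev p M u (f 1) N ω * truncDev p M u (f 2) N ω ∂P|
      ≤ 12 * (∫ v, M v ^ 5 ∂p) ^ 3 * (√(N : ℝ))⁻¹ ^ 3 := by
  have hs := one_le_sqrt_natCast hN
  have mf := fun i => hM.measurable_truncCentered (s := √N) (hf i)
  have bf := fun i => hM.bdd_truncCentered (s := √N) (hf i) (hfM i)
  have zf := fun i => hM.integral_truncCentered (s := √N) (hf i) (hfM i)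
  have hS3 := integral_sampleSum_mul_mul hu hind (f := fun i => truncCentered p M √N (f i))
    mf bf zf N
  have hS2 := fun i j => integral_sampleSum_mul hu hind
    (f := fun k => truncCentered p M √N (f (![i, j] k))) (fun _ => mf _) (fun _ => bf _)
    (fun _ => zf _) N
  simp only [Matrix.cons_val_zero, Matrix.cons_val_one] at hS2
  have hS1 := fun i => integral_sampleSum hu (bf i).integrable N
  simp only [zf, mul_zero] at hS1
  have hb := fun i => hM.abs_truncBias_le (hf i) (hfM i) hN
  have h3 := hM.abs_integral_truncCentered_mul_mul_le hs hf hfM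
  have h2 := fun i j => hM.abs_integral_truncCentered_mul_le hs (hf i) (hfM i) (hf j) (hfM j)
  have bS := fun i => (bf i).sampleSum hu N
  simp_rw [truncDev_eq p M u _ hN]
  set S : Fin 3 → Ω → ℝ := fun i => sampleSum u (truncCentered p M √N (f i)) N
  set b : Fin 3 → ℝ := fun i => ∫ v, trunc M √N (f i) v ∂p - ∫ v, f i v ∂p
  set m := ∫ v, M v ^ 5 ∂p
  have hm1 : 1 ≤ m := hM.one_le_moment
  set t := (√(N : ℝ))⁻¹ with ht
  have ht0 : 0 < t := by positivity
  have ht1 : t ≤ 1 := inv_le_one_of_one_le₀ hs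
  have hst : t * √(N : ℝ) = 1 := inv_mul_cancel₀ (by positivity)
  have hNi : (N : ℝ)⁻¹ = t ^ 2 := natCast_inv_eq N
  have hNN : (t ^ 2) * N = 1 := by rw [← hNi]; exact inv_mul_cancel₀ (by positivity)
  rw [hNi]
  have hexp : ∫ ω, (t ^ 2 * S 0 ω + b 0) * (t ^ 2 * S 1 ω + b 1) * (t ^ 2 * S 2 ω + b 2) ∂P
      = t ^ 4 * (∫ v, truncCentered p M √N (f 0) v * truncCentered p M √N (f 1) v
            * truncCentered p M √N (f 2) v ∂p)
        + (t ^ 2 * b 2 * (∫ v, truncCentered p M √N (f 0) v * truncCentered p M √N (f 1) v ∂p)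
        + (t ^ 2 * b 1 * (∫ v, truncCentered p M √N (f 0) v * truncCentered p M √N (f 2) v ∂p)
        + (t ^ 2 * b 0 * (∫ v, truncCentered p M √N (f 1) v * truncCentered p M √N (f 2) v ∂p)
        + b 0 * b 1 * b 2))) := by
    have : ∀ ω, (t ^ 2 * S 0 ω + b 0) * (t ^ 2 * S 1 ω + b 1) * (t ^ 2 * S 2 ω + b 2)
        = t ^ 6 * (S 0 ω * S 1 ω * S 2 ω)
          + (t ^ 4 * b 2 * (S 0 ω * S 1 ω) + (t ^ 4 * b 1 * (S 0 ω * S 2 ω)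
          + (t ^ 4 * b 0 * (S 1 ω * S 2 ω) + (t ^ 2 * b 1 * b 2 * S 0 ω
          + (t ^ 2 * b 0 * b 2 * S 1 ω + (t ^ 2 * b 0 * b 1 * S 2 ω + b 0 * b 1 * b 2)))))) :=
      fun ω => by ring
    simp_rw [this]
    have c : ∀ a : ℝ, BddAEMeasurable (fun _ : Ω => a) P := BddAEMeasurable.const
    have i1 := (c (t ^ 6)).mul (((bS 0).mul (bS 1)).mul (bS 2))
    have i2 := (c (t ^ 4 * b 2)).mul ((bS 0).mul (bS 1))
    have i3 := (c (t ^ 4 * b 1)).mul ((bS 0).mul (bS 2))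
    have i4 := (c (t ^ 4 * b 0)).mul ((bS 1).mul (bS 2))
    have i5 := (c (t ^ 2 * b 1 * b 2)).mul (bS 0)
    have i6 := (c (t ^ 2 * b 0 * b 2)).mul (bS 1)
    have i7 := (c (t ^ 2 * b 0 * b 1)).mul (bS 2)
    have j7 := i7.add (c (b 0 * b 1 * b 2))
    have j6 := i6.add j7
    have j5 := i5.add j6
    have j4 := i4.add j5
    have j3 := i3.add j4
    have j2 := i2.add j3
    rw [integral_add i1.integrable j2.integrable, integral_add i2.integrable j3.integrable,
      integral_add i3.integrable j4.integrable, integral_add i4.integrable j5.integrable,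
      integral_add i5.integrable j6.integrable, integral_add i6.integrable j7.integrable,
      integral_add i7.integrable (c _).integrable]
    simp only [integral_const_mul, hS1, hS2, hS3, integral_const, probReal_univ, smul_eq_mul,
      mul_zero, one_mul, zero_add]
    set I3 := ∫ v, truncCentered p M √N (f 0) v * truncCentered p M √N (f 1) v
            * truncCentered p M √N (f 2) v ∂p
    set I2 := ∫ v, truncCentered p M √N (f 0) v * truncCentered p M √N (f 1) v ∂p
    set I1 := ∫ v, truncCentered p M √N (f 0) v * truncCentered p M √N (f 2) v ∂p
    set I0 := ∫ v, truncCentered p M √N (f 1) v * truncCentered p M √N (f 2) v ∂p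
    linear_combination (t ^ 4 * I3 + t ^ 2 * b 2 * I2 + t ^ 2 * b 1 * I1 + t ^ 2 * b 0 * I0) * hNN
  rw [hexp]
  have hmix : ∀ i j k, |t ^ 2 * b i
      * (∫ v, truncCentered p M √N (f j) v * truncCentered p M √N (f k) v ∂p)|
      ≤ m ^ 3 * t ^ 3 := fun i j k => by
    rw [abs_mul, abs_mul, abs_of_nonneg (by positivity : 0 ≤ t ^ 2)]
    calc _ ≤ 1 * (t ^ 3 * m) * m := by
          gcongr
          exacts [pow_le_one₀ ht0.le ht1, hb i, h2 j k]
      _ = m ^ 2 * t ^ 3 := by ring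
      _ ≤ m ^ 3 * t ^ 3 := by gcongr; norm_num
  have hbbb : |b 0 * b 1 * b 2| ≤ m ^ 3 * t ^ 3 := by
    rw [abs_mul, abs_mul]
    calc _ ≤ (t ^ 3 * m) * (t ^ 3 * m) * (t ^ 3 * m) := by
          gcongr
          exacts [hb 0, hb 1, hb 2]
      _ = m ^ 3 * (t ^ 3) ^ 3 := by ring
      _ ≤ m ^ 3 * t ^ 3 := by
          gcongr
          exact pow_le_of_le_one ht0.le ht1 (by norm_num)
  have hlead : |t ^ 4 * (∫ v, truncCentered p M √N (f 0) v * truncCentered p M √N (f 1) v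
            * truncCentered p M √N (f 2) v ∂p)| ≤ 8 * m ^ 3 * t ^ 3 := by
    rw [abs_mul, abs_of_nonneg (by positivity : 0 ≤ t ^ 4)]
    calc _ ≤ t ^ 4 * (8 * √N * m ^ 3) := by gcongr
      _ = 8 * m ^ 3 * t ^ 3 := by linear_combination 8 * m ^ 3 * t ^ 3 * hst
  refine (abs_add_le _ _).trans ?_
  refine (add_le_add hlead ((abs_add_le _ _).trans (add_le_add (hmix 2 0 1) ((abs_add_le _ _).trans
    (add_le_add (hmix 1 0 2) ((abs_add_le _ _).trans (add_le_add (hmix 0 1 2) hbbb))))))).trans ?_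
  linarith

end IsEnvelope

end TruncatedDeviations

/-! ## Algebra of the empirical normal equations -/

section NormalEquations

variable {U : Type*} {K N : ℕ}

theorem dotProduct_empGram_mulVec (X : Fin K → U → ℝ) (s : Fin N → U) (a b : Fin K → ℝ) :
    a ⬝ᵥ (empGram X s *ᵥ b)
      = (N : ℝ)⁻¹ * ∑ n, (∑ i, a i * X i (s n)) * ∑ j, b j * X j (s n) := by
  simp only [dotProduct, Matrix.mulVec, empGram, Matrix.of_apply, Finset.mul_sum, Finset.sum_mul]
  rw [Finset.sum_congr rfl fun i _ => Finset.sum_comm, Finset.sum_comm]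
  refine Finset.sum_congr rfl fun n _ => ?_
  rw [Finset.sum_comm]
  refine Finset.sum_congr rfl fun i _ => Finset.sum_congr rfl fun j _ => ?_
  ring

theorem dotProduct_empCorr (X : Fin K → U → ℝ) (y : U → ℝ) (s : Fin N → U) (a : Fin K → ℝ) :
    a ⬝ᵥ empCorr X y s = (N : ℝ)⁻¹ * ∑ n, (∑ i, a i * X i (s n)) * y (s n) := by
  simp only [dotProduct, empCorr, Finset.mul_sum, Finset.sum_mul]
  rw [Finset.sum_comm]
  refine Finset.sum_congr rfl fun i _ => Finset.sum_congr rfl fun j _ => ?_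
  ring

theorem transpose_empGram (X : Fin K → U → ℝ) (s : Fin N → U) :
    (empGram X s)ᵀ = empGram X s := by
  ext i j
  simp [empGram, mul_comm]

/-- The normal equations are solvable even when `G` is singular: the residual `w` lies in the kernel
of `G`, so `w·X` vanishes at every sample. Hence `w` is orthogonal to `R`, as well as to the range
of `G`, and so to itself. -/
theorem empGram_mulVec_pinv (X : Fin K → U → ℝ) (y : U → ℝ) (s : Fin N → U) :
    empGram X s *ᵥ (pinv (empGram X s) *ᵥ empCorr X y s) = empCorr X y s := by
  set G := empGram X s with hG
  set R := empCorr X y s with hR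
  have hsym : Gᵀ = G := transpose_empGram X s
  have hpi := isMoorePenrose_pinv hsym
  set w := R - G *ᵥ (pinv G *ᵥ R) with hw
  have hGG : G * (G * pinv G) = G := by
    have := congrArg Matrix.transpose hpi.mul_mul_left
    rwa [Matrix.transpose_mul, hpi.isSymm_left, hsym] at this
  have hGw : G *ᵥ w = 0 := by
    rw [hw, Matrix.mulVec_sub, Matrix.mulVec_mulVec, Matrix.mulVec_mulVec, mul_assoc, hGG, sub_self]
  have hfit : ∀ n, (N : ℝ)⁻¹ * ((∑ i, w i * X i (s n)) * (∑ i, w i * X i (s n))) = 0 := by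
    have h0 : w ⬝ᵥ (G *ᵥ w) = 0 := by rw [hGw, dotProduct_zero]
    rw [hG, dotProduct_empGram_mulVec, Finset.mul_sum] at h0
    have := (Finset.sum_eq_zero_iff_of_nonneg (fun n _ => mul_nonneg (by positivity)
      (mul_self_nonneg (∑ i, w i * X i (s n))))).1 h0
    exact fun n => this n (Finset.mem_univ n)
  have hwR : w ⬝ᵥ R = 0 := by
    rw [hR, dotProduct_empCorr, Finset.mul_sum]
    refine Finset.sum_eq_zero fun n _ => ?_
    rcases mul_eq_zero.1 (hfit n) with h | h
    · rw [h, zero_mul]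
    · rw [mul_self_eq_zero.1 h]; ring
  have hww : w ⬝ᵥ w = 0 := by
    have : w ⬝ᵥ (G *ᵥ (pinv G *ᵥ R)) = 0 := by
      rw [Matrix.dotProduct_mulVec, ← Matrix.mulVec_transpose, hsym, hGw, zero_dotProduct]
    conv_lhs => rw [hw]
    rw [← hw, sub_dotProduct, dotProduct_comm, hwR, dotProduct_comm, this, sub_zero]
  exact (sub_eq_zero.1 (dotProduct_self_eq_zero.1 hww)).symm

theorem dotProduct_empCorr_eq_of_mulVec_eq {X : Fin K → U → ℝ} {y : U → ℝ} {s : Fin N → U}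
    {v : Fin K → ℝ} (hv : empGram X s *ᵥ v = empCorr X y s) (a : Fin K → ℝ) :
    (N : ℝ)⁻¹ * ∑ n, (∑ i, a i * X i (s n)) * ∑ j, v j * X j (s n)
      = (N : ℝ)⁻¹ * ∑ n, (∑ i, a i * X i (s n)) * y (s n) := by
  rw [← dotProduct_empGram_mulVec, hv, dotProduct_empCorr]

theorem empCorr_dotProduct_nonneg {X : Fin K → U → ℝ} {y : U → ℝ} {s : Fin N → U}
    {v : Fin K → ℝ} (hv : empGram X s *ᵥ v = empCorr X y s) : 0 ≤ empCorr X y s ⬝ᵥ v := by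
  rw [dotProduct_comm, ← hv, dotProduct_empGram_mulVec]
  exact mul_nonneg (by positivity) (Finset.sum_nonneg fun n _ => mul_self_nonneg _)

/-- The difference of the two sides is the residual mean square of the fit. This bound needs no
control of the smallest eigenvalue of the Gram matrix. -/
theorem empCorr_dotProduct_le {X : Fin K → U → ℝ} {y : U → ℝ} {s : Fin N → U}
    {v : Fin K → ℝ} (hv : empGram X s *ᵥ v = empCorr X y s) :
    empCorr X y s ⬝ᵥ v ≤ (N : ℝ)⁻¹ * ∑ n, y (s n) ^ 2 := by
  have h1 := dotProduct_empCorr_eq_of_mulVec_eq hv v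
  rw [dotProduct_comm, dotProduct_empCorr]
  have h2 : 0 ≤ (N : ℝ)⁻¹ * ∑ n, (y (s n) - ∑ i, v i * X i (s n)) ^ 2 :=
    mul_nonneg (by positivity) (Finset.sum_nonneg fun n _ => sq_nonneg _)
  have h3 : (N : ℝ)⁻¹ * ∑ n, (y (s n) - ∑ i, v i * X i (s n)) ^ 2
      = (N : ℝ)⁻¹ * ∑ n, y (s n) ^ 2 - 2 * ((N : ℝ)⁻¹ * ∑ n, (∑ i, v i * X i (s n)) * y (s n))
        + (N : ℝ)⁻¹ * ∑ n, (∑ i, v i * X i (s n)) * ∑ i, v i * X i (s n) := by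
    simp only [Finset.mul_sum (a := (N : ℝ)⁻¹), Finset.mul_sum (a := (2 : ℝ)),
      ← Finset.sum_sub_distrib, ← Finset.sum_add_distrib]
    exact Finset.sum_congr rfl fun n _ => by ring
  linarith

/-- Completing the square at `v` shows that the fit maximizes a concave quadratic, and rational
weights suffice by density. A countable supremum makes the fit measurable although the
pseudo-inverse is discontinuous. -/
theorem isLUB_empCorr_dotProduct {X : Fin K → U → ℝ} {y : U → ℝ} {s : Fin N → U}
    {v : Fin K → ℝ} (hv : empGram X s *ᵥ v = empCorr X y s) :
    IsLUB {a | ∃ w : Fin K → ℚ, 2 * (empCorr X y s ⬝ᵥ fun i => (w i : ℝ))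
      - (fun i => (w i : ℝ)) ⬝ᵥ (empGram X s *ᵥ fun i => (w i : ℝ)) = a}
      (empCorr X y s ⬝ᵥ v) := by
  have hval : ∀ w : Fin K → ℝ, 2 * (empCorr X y s ⬝ᵥ w) - w ⬝ᵥ (empGram X s *ᵥ w)
      = empCorr X y s ⬝ᵥ v - (w - v) ⬝ᵥ (empGram X s *ᵥ (w - v)) := fun w => by
    have hc : v ⬝ᵥ (empGram X s *ᵥ w) = empCorr X y s ⬝ᵥ w := by
      rw [Matrix.dotProduct_mulVec, ← Matrix.mulVec_transpose, transpose_empGram, hv]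
    rw [Matrix.mulVec_sub, hv, sub_dotProduct, dotProduct_sub, dotProduct_sub, hc,
      dotProduct_comm w (empCorr X y s), dotProduct_comm v (empCorr X y s)]
    ring
  constructor
  · rintro _ ⟨w, rfl⟩
    rw [hval, dotProduct_empGram_mulVec]
    exact sub_le_self _ (mul_nonneg (by positivity) (Finset.sum_nonneg fun n _ => mul_self_nonneg _))
  · intro b hb
    have hcont : Continuous fun w : Fin K → ℝ =>
        2 * (empCorr X y s ⬝ᵥ w) - w ⬝ᵥ (empGram X s *ᵥ w) := by
      simp only [dotProduct, Matrix.mulVec]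
      fun_prop
    have hdense : DenseRange fun (w : Fin K → ℚ) (i : Fin K) => ((w i : ℚ) : ℝ) :=
      DenseRange.piMap fun _ => Rat.denseRange_cast
    have hall : ∀ w : Fin K → ℝ, 2 * (empCorr X y s ⬝ᵥ w) - w ⬝ᵥ (empGram X s *ᵥ w) ≤ b :=
      fun w => hdense.induction_on w (isClosed_le hcont continuous_const) fun w => hb ⟨w, rfl⟩
    simpa [hval] using hall v

/-- The fitted function is the same in both coordinate systems; removing `c·x` from it leaves a
least-squares fit of `z`. The relations are required only at the sample points, so relations valid
almost everywhere can be used. -/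
theorem exists_empGram_mulVec_eq_of_basis_change {d : ℕ} {X : Fin K → U → ℝ} {y : U → ℝ}
    {x : Fin d → U → ℝ} {z : U → ℝ} {s : Fin N → U} {A : Fin K → Fin d → ℝ} {B : Fin d → Fin K → ℝ}
    {c : Fin d → ℝ} (hA : ∀ i n, X i (s n) = ∑ j, A i j * x j (s n))
    (hB : ∀ j n, x j (s n) = ∑ i, B j i * X i (s n))
    (hy : ∀ n, y (s n) = ∑ j, c j * x j (s n) + z (s n))
    {v : Fin K → ℝ} (hv : empGram X s *ᵥ v = empCorr X y s) :
    ∃ v', empGram x s *ᵥ v' = empCorr x z s ∧ empCorr X y s ⬝ᵥ v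
      = c ⬝ᵥ (empGram x s *ᵥ c) + 2 * (c ⬝ᵥ empCorr x z s) + empCorr x z s ⬝ᵥ v' := by
  set v' : Fin d → ℝ := fun j => ∑ i, v i * A i j - c j with hv'
  have hfit : ∀ n, ∑ i, v i * X i (s n) = ∑ j, v' j * x j (s n) + ∑ j, c j * x j (s n) := by
    intro n
    simp only [hA, hv', sub_mul, Finset.sum_sub_distrib, sub_add_cancel, Finset.mul_sum,
      Finset.sum_mul]
    rw [Finset.sum_comm]
    exact Finset.sum_congr rfl fun i _ => Finset.sum_congr rfl fun j _ => by ring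
  have hsol : empGram x s *ᵥ v' = empCorr x z s := by
    classical
    ext j
    -- Testing the old normal equations against `x j`, expressed through the readouts, gives the
    -- `j`-th new one.
    have h := dotProduct_empCorr_eq_of_mulVec_eq hv (B j)
    simp only [← hB, hfit, hy] at h
    have e1 := dotProduct_empGram_mulVec x s (Pi.single j 1) v'
    have e2 := dotProduct_empCorr x z s (Pi.single j 1)
    simp only [single_one_dotProduct, Pi.single_apply, ite_mul, one_mul, zero_mul,
      Finset.sum_ite_eq', Finset.mem_univ, if_true] at e1 e2
    rw [e1, e2]
    simp only [mul_add, Finset.sum_add_distrib] at h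
    linarith
  refine ⟨v', hsol, ?_⟩
  have hcv : c ⬝ᵥ (empGram x s *ᵥ v') = c ⬝ᵥ empCorr x z s := by rw [hsol]
  rw [dotProduct_comm (empCorr X y s), dotProduct_comm (empCorr x z s), two_mul]
  -- Only one of the two copies of `c·r` becomes `c·G v'`; the four terms are then those of `(v'·x +
  -- c·x)(c·x + z)`.
  nth_rewrite 1 [← hcv]
  simp only [dotProduct_empGram_mulVec, dotProduct_empCorr, hfit, hy, ← mul_add,
    ← Finset.sum_add_distrib]
  congr 1
  exact Finset.sum_congr rfl fun n _ => by rw [Finset.sum_add_distrib]; ring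

end NormalEquations

/-! ### Second-order expansion of `r·v` when `G v = r` and `G` is near the identity -/

section QuadraticExpansion

variable {ι : Type*} [Fintype ι]

theorem dotProduct_sq_le (a b : ι → ℝ) : (a ⬝ᵥ b) ^ 2 ≤ (a ⬝ᵥ a) * (b ⬝ᵥ b) := by
  simpa only [dotProduct, pow_two] using Finset.sum_mul_sq_le_sq_mul_sq Finset.univ a b

theorem mulVec_dotProduct_self_le (E : Matrix ι ι ℝ) (a : ι → ℝ) :
    (E *ᵥ a) ⬝ᵥ (E *ᵥ a) ≤ (∑ i, ∑ j, E i j ^ 2) * (a ⬝ᵥ a) := by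
  rw [Finset.sum_mul]
  refine Finset.sum_le_sum fun i _ => ?_
  have := dotProduct_sq_le (E i) a
  simpa only [dotProduct, pow_two, Matrix.mulVec] using this

theorem abs_dotProduct_mulVec_le (E : Matrix ι ι ℝ) (r : ι → ℝ) :
    |r ⬝ᵥ (E *ᵥ r)| ≤ (r ⬝ᵥ r) * (1 + ∑ i, ∑ j, E i j ^ 2) / 2 := by
  have h1 := dotProduct_sq_le r (E *ᵥ r)
  have h2 := mulVec_dotProduct_self_le E r
  set F := ∑ i, ∑ j, E i j ^ 2
  have hF : 0 ≤ F := Finset.sum_nonneg fun i _ => Finset.sum_nonneg fun j _ => sq_nonneg _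
  have hR : 0 ≤ r ⬝ᵥ r := Finset.sum_nonneg fun i _ => mul_self_nonneg _
  refine abs_le_of_sq_le_sq (h1.trans ?_) (by positivity)
  nlinarith [mul_le_mul_of_nonneg_left h2 hR, sq_nonneg ((r ⬝ᵥ r) * (1 - F))]

theorem abs_sub_quadratic_le_one_add (E : Matrix ι ι ℝ) (r : ι → ℝ) :
    |r ⬝ᵥ r - r ⬝ᵥ (E *ᵥ r)| ≤ 1 + (r ⬝ᵥ r) ^ 2 + (∑ i, ∑ j, E i j ^ 2) ^ 2 := by
  have h := abs_dotProduct_mulVec_le E r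
  have hR : 0 ≤ r ⬝ᵥ r := Finset.sum_nonneg fun i _ => mul_self_nonneg _
  set F := ∑ i, ∑ j, E i j ^ 2
  set R := r ⬝ᵥ r
  refine (abs_sub _ _).trans ?_
  rw [abs_of_nonneg hR]
  nlinarith [sq_nonneg (R - F), sq_nonneg (R - 1), sq_nonneg (R - 3 / 2)]

/-- Substituting `v = r - E v` twice gives the exact remainder `(E v)·(E r)`, without inverting `G`.
If the squared Frobenius norm `F` of `E` is small, `v` is comparable to `r` and the remainder is of
fourth order; otherwise `F²` is bounded below and absorbs the a priori bound. -/
theorem abs_dotProduct_sub_quadratic_le [DecidableEq ι] {G : Matrix ι ι ℝ} (hG : Gᵀ = G)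
    {r v : ι → ℝ} (hv : G *ᵥ v = r) {η σ : ℝ} (hσ : 0 ≤ σ) (h0 : 0 ≤ r ⬝ᵥ v)
    (hle : r ⬝ᵥ v ≤ σ + η) :
    |r ⬝ᵥ v - (r ⬝ᵥ r - r ⬝ᵥ ((G - 1) *ᵥ r))|
      ≤ (16 * σ + 33) * ((r ⬝ᵥ r) ^ 2 + (∑ i, ∑ j, (G - 1) i j ^ 2) ^ 2 + η ^ 4) := by
  set E := G - 1 with hE
  have hEsym : Eᵀ = E := by rw [hE, Matrix.transpose_sub, hG, Matrix.transpose_one]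
  have hEv : E *ᵥ v = r - v := by rw [hE, Matrix.sub_mulVec, hv, Matrix.one_mulVec]
  have hEt : ∀ a b : ι → ℝ, a ⬝ᵥ (E *ᵥ b) = (E *ᵥ a) ⬝ᵥ b := fun a b => by
    rw [Matrix.dotProduct_mulVec, ← Matrix.mulVec_transpose, hEsym]
  have h1 := mulVec_dotProduct_self_le E v
  have h2 := mulVec_dotProduct_self_le E r
  have h3 := dotProduct_sq_le (E *ᵥ v) (E *ᵥ r)
  have h4 := abs_sub_quadratic_le_one_add E r
  have hid : r ⬝ᵥ v - (r ⬝ᵥ r - r ⬝ᵥ (E *ᵥ r)) = (E *ᵥ v) ⬝ᵥ (E *ᵥ r) := by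
    have : v ⬝ᵥ (E *ᵥ r) = (r - v) ⬝ᵥ r := by rw [hEt, hEv]
    rw [hEv, sub_dotProduct, this, sub_dotProduct, dotProduct_comm v r]
    ring
  have hF : 0 ≤ ∑ i, ∑ j, E i j ^ 2 :=
    Finset.sum_nonneg fun i _ => Finset.sum_nonneg fun j _ => sq_nonneg _
  have hR : 0 ≤ r ⬝ᵥ r := Finset.sum_nonneg fun i _ => mul_self_nonneg _
  have hV : 0 ≤ v ⬝ᵥ v := Finset.sum_nonneg fun i _ => mul_self_nonneg _
  have hVE : 0 ≤ (E *ᵥ v) ⬝ᵥ (E *ᵥ v) := Finset.sum_nonneg fun i _ => mul_self_nonneg _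
  have hRE : 0 ≤ (E *ᵥ r) ⬝ᵥ (E *ᵥ r) := Finset.sum_nonneg fun i _ => mul_self_nonneg _
  have hVR : v ⬝ᵥ v ≤ 2 * (r ⬝ᵥ r) + 2 * ((E *ᵥ v) ⬝ᵥ (E *ᵥ v)) := by
    rw [hEv]
    simp only [dotProduct, Finset.mul_sum, ← Finset.sum_add_distrib, Pi.sub_apply]
    exact Finset.sum_le_sum fun i _ => by nlinarith [sq_nonneg (2 * r i - v i)]
  set F := ∑ i, ∑ j, E i j ^ 2
  set R := r ⬝ᵥ r
  set V := v ⬝ᵥ v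
  have hη : 0 ≤ η ^ 4 := by positivity
  rcases le_or_gt F (1 / 4) with hF4 | hF4
  -- From `V ≤ 2 R + 2 F V` and `F ≤ 1 / 4`.
  · have hV4 : V ≤ 4 * R := by nlinarith
    have hmain : |(E *ᵥ v) ⬝ᵥ (E *ᵥ r)| ≤ 2 * F * R := by
      refine abs_le_of_sq_le_sq (h3.trans ?_) (by positivity)
      calc _ ≤ (F * V) * (F * R) := by gcongr
        _ ≤ (F * (4 * R)) * (F * R) := by gcongr
        _ = _ := by ring
    rw [hid]
    have h5 : 2 * F * R ≤ R ^ 2 + F ^ 2 := by nlinarith [sq_nonneg (F - R)]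
    have h6 : 1 * (R ^ 2 + F ^ 2 + η ^ 4) ≤ (16 * σ + 33) * (R ^ 2 + F ^ 2 + η ^ 4) := by
      gcongr; linarith
    linarith
  -- The crude bound is `(σ + 2) + R² + F² + η⁴`; paying for `σ + 2` with `16 F²` yields the
  -- constant `16 σ + 33`.
  · have hF16 : 1 ≤ 16 * F ^ 2 := by nlinarith
    have hη1 : η ≤ 1 + η ^ 4 := by nlinarith [sq_nonneg (η - 1), sq_nonneg (η ^ 2 - 1), sq_nonneg η]
    refine (abs_sub _ _).trans ?_
    rw [abs_of_nonneg h0]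
    nlinarith [mul_nonneg hσ (sq_nonneg R), mul_nonneg hσ hη, mul_nonneg hσ (sub_nonneg.2 hF16),
      sq_nonneg R]

end QuadraticExpansion

/-! ## Expected fit of a target orthogonal to orthonormal readouts -/

section OrthonormalReadouts

variable {U Ω : Type*} [MeasurableSpace U] {p : Measure U} {u : ℕ → Ω → U} {M : U → ℝ} {d : ℕ}

/-- Truncated empirical correlations of `x` with `z`, centred at their means. -/
noncomputable def truncCorr (p : Measure U) (M : U → ℝ) (u : ℕ → Ω → U) (x : Fin d → U → ℝ)
    (z : U → ℝ) (N : ℕ) (ω : Ω) : Fin d → ℝ :=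
  fun i => truncDev p M u (fun v => x i v * z v) N ω

/-- Truncated empirical Gram matrix of `x`, centred at its mean. -/
noncomputable def truncGram (p : Measure U) (M : U → ℝ) (u : ℕ → Ω → U) (x : Fin d → U → ℝ)
    (N : ℕ) (ω : Ω) : Matrix (Fin d) (Fin d) ℝ :=
  Matrix.of fun i j => truncDev p M u (fun v => x i v * x j v) N ω

/-- Second order approximation of the empirical fit. -/
noncomputable def truncQuadratic (p : Measure U) (M : U → ℝ) (u : ℕ → Ω → U) (x : Fin d → U → ℝ)
    (z : U → ℝ) (N : ℕ) (ω : Ω) : ℝ :=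
  truncCorr p M u x z N ω ⬝ᵥ truncCorr p M u x z N ω
    - truncCorr p M u x z N ω ⬝ᵥ (truncGram p M u x N ω *ᵥ truncCorr p M u x z N ω)

/-- Sum of the fourth powers of the truncated deviations. -/
noncomputable def truncQuartic (p : Measure U) (M : U → ℝ) (u : ℕ → Ω → U) (x : Fin d → U → ℝ)
    (z : U → ℝ) (N : ℕ) (ω : Ω) : ℝ :=
  d * ∑ i, truncDev p M u (fun v => x i v * z v) N ω ^ 4
    + d * d * ∑ i, ∑ j, truncDev p M u (fun v => x i v * x j v) N ω ^ 4
    + truncDev p M u (fun v => z v ^ 2) N ω ^ 4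

theorem truncDev_of_forall_le {N : ℕ} {ω : Ω} (h : ∀ n < N, M (u n ω) ≤ √N) (f : U → ℝ) :
    truncDev p M u f N ω = (N : ℝ)⁻¹ * ∑ n : Fin N, f (u n ω) - ∫ v, f v ∂p := by
  rw [truncDev, sampleSum, Fin.sum_univ_eq_sum_range (fun n => f (u n ω)) N]
  congr 2
  exact Finset.sum_congr rfl fun n hn => if_pos (h n (Finset.mem_range.1 hn))

theorem quartic_le_truncQuartic (x : Fin d → U → ℝ) (z : U → ℝ) (N : ℕ) (ω : Ω) :
    (truncCorr p M u x z N ω ⬝ᵥ truncCorr p M u x z N ω) ^ 2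
      + (∑ i, ∑ j, truncGram p M u x N ω i j ^ 2) ^ 2
      + truncDev p M u (fun v => z v ^ 2) N ω ^ 4 ≤ truncQuartic p M u x z N ω := by
  have h (f : Fin d → ℝ) : (∑ i, f i) ^ 2 ≤ d * ∑ i, f i ^ 2 := by
    simpa using sq_sum_le_card_mul_sum_sq (s := Finset.univ) (f := f)
  refine add_le_add (add_le_add ?_ ?_) le_rfl
  · refine (h _).trans_eq ?_
    congr 1
    exact Finset.sum_congr rfl fun i _ => by rw [truncCorr]; ring
  · refine (h _).trans ?_
    rw [mul_assoc]
    refine mul_le_mul_of_nonneg_left ?_ (Nat.cast_nonneg d)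
    rw [Finset.mul_sum]
    refine Finset.sum_le_sum fun i _ => ?_
    refine (h _).trans_eq ?_
    congr 1
    exact Finset.sum_congr rfl fun j _ => by rw [truncGram, Matrix.of_apply]; ring

/-- A bound valid for every sample. If no point is truncated, the truncated deviations are the true
ones and the expansion applies. Otherwise the number of truncated points, the second sum on the
right, is at least `1` and pays for the constants, while the third sum restores the truncated part
of the mean of `z²`. -/
theorem abs_empCorr_dotProduct_sub_truncQuadratic_le {x : Fin d → U → ℝ} {z : U → ℝ}
    (hxx : ∀ i j, ∫ v, x i v * x j v ∂p = if i = j then 1 else 0)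
    (hxz : ∀ i, ∫ v, x i v * z v ∂p = 0) {N : ℕ} {ω : Ω} {v : Fin d → ℝ}
    (hv : empGram x (fun n : Fin N => u n ω) *ᵥ v = empCorr x z (fun n : Fin N => u n ω)) :
    |empCorr x z (fun n : Fin N => u n ω) ⬝ᵥ v - truncQuadratic p M u x z N ω|
      ≤ (16 * (∫ v, z v ^ 2 ∂p) + 33) * truncQuartic p M u x z N ω
        + ((∫ v, z v ^ 2 ∂p) + 3) * sampleSum u (fun v => 1 - trunc M √N (fun _ => 1) v) N ω
        + (N : ℝ)⁻¹ * sampleSum u (fun v => z v ^ 2 - trunc M √N (fun v => z v ^ 2) v) N ω := by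
  have h0 := empCorr_dotProduct_nonneg hv
  have hle := empCorr_dotProduct_le hv
  have hQ := quartic_le_truncQuartic (p := p) (M := M) (u := u) x z N ω
  set σ := ∫ v, z v ^ 2 ∂p with hσ
  have hσ0 : 0 ≤ σ := integral_nonneg fun v => sq_nonneg _
  set η := truncDev p M u (fun v => z v ^ 2) N ω with hη
  have hη1 : η ≤ 1 + η ^ 4 := by nlinarith [sq_nonneg (η - 1), sq_nonneg (η ^ 2 - 1), sq_nonneg η]
  set R := truncCorr p M u x z N ω ⬝ᵥ truncCorr p M u x z N ω
  set F := ∑ i, ∑ j, truncGram p M u x N ω i j ^ 2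
  have hQ0 : 0 ≤ truncQuartic p M u x z N ω := le_trans (by positivity) hQ
  have hbad0 : ∀ v, 0 ≤ 1 - trunc M √N (fun _ => (1 : ℝ)) v := fun v => by
    simp only [trunc]; split_ifs <;> norm_num
  have hbadz : 0 ≤ (N : ℝ)⁻¹ * sampleSum u (fun v => z v ^ 2 - trunc M √N (fun v => z v ^ 2) v) N ω := by
    refine mul_nonneg (by positivity) (Finset.sum_nonneg fun n _ => ?_)
    simp only [trunc]; split_ifs
    · simp
    · simpa using sq_nonneg _
  have hbad1 : 0 ≤ sampleSum u (fun v => 1 - trunc M √N (fun _ => 1) v) N ω :=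
    Finset.sum_nonneg fun n _ => hbad0 _
  by_cases hgood : ∀ n < N, M (u n ω) ≤ √N
  · have hcorr : truncCorr p M u x z N ω = empCorr x z (fun n : Fin N => u n ω) := by
      ext i
      rw [truncCorr, truncDev_of_forall_le hgood, hxz, sub_zero, empCorr]
    have hgram : truncGram p M u x N ω = empGram x (fun n : Fin N => u n ω) - 1 := by
      ext i j
      rw [truncGram, Matrix.of_apply, truncDev_of_forall_le hgood, hxx, Matrix.sub_apply,
        empGram, Matrix.of_apply, Matrix.one_apply]
    have hη' : η = (N : ℝ)⁻¹ * ∑ n : Fin N, z (u n ω) ^ 2 - σ := truncDev_of_forall_le hgood _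
    have hmain := abs_dotProduct_sub_quadratic_le (transpose_empGram x _) hv (η := η) hσ0 h0
      (by rw [hη']; linarith)
    rw [← hgram] at hmain
    simp only [← hcorr] at hmain
    rw [← hcorr, truncQuadratic]
    have h5 := mul_le_mul_of_nonneg_left hQ (by positivity : 0 ≤ 16 * σ + 33)
    have h6 := mul_nonneg (by positivity : 0 ≤ σ + 3) hbad1
    linarith [hmain.trans h5]
  · push Not at hgood
    obtain ⟨n₀, hn₀, hbad⟩ := hgood
    have hone : 1 ≤ sampleSum u (fun v => 1 - trunc M √N (fun _ => 1) v) N ω := by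
      refine le_trans ?_ (Finset.single_le_sum (fun n _ => hbad0 (u n ω))
        (Finset.mem_range.2 hn₀))
      simp [trunc, not_le.2 hbad]
    have hsplit : (N : ℝ)⁻¹ * ∑ n : Fin N, z (u n ω) ^ 2
        = σ + η + (N : ℝ)⁻¹ * sampleSum u (fun v => z v ^ 2 - trunc M √N (fun v => z v ^ 2) v) N ω := by
      rw [hη, truncDev, sampleSum, sampleSum, Finset.sum_sub_distrib,
        Fin.sum_univ_eq_sum_range (fun n => z (u n ω) ^ 2) N]
      ring
    have hquad : |truncQuadratic p M u x z N ω| ≤ 1 + R ^ 2 + F ^ 2 :=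
      abs_sub_quadratic_le_one_add _ _
    refine (abs_sub _ _).trans ?_
    rw [abs_of_nonneg h0]
    have h6 := mul_le_mul_of_nonneg_left hone (by positivity : 0 ≤ σ + 3)
    have h7 : 1 * truncQuartic p M u x z N ω ≤ (16 * σ + 33) * truncQuartic p M u x z N ω :=
      mul_le_mul_of_nonneg_right (by linarith) hQ0
    linarith

variable [MeasurableSpace Ω] {P : Measure Ω} [IsProbabilityMeasure p] [IsProbabilityMeasure P]

/-- Any integrable `q` given almost surely by some solution `v` is allowed, because the solution
coming from the change of basis need not be the pseudo-inverse one and no measurable choice of it is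
made. -/
theorem exists_abs_integral_sub_le (hM : IsEnvelope M p) (hu : ∀ n, HasLaw (u n) p P)
    (hind : iIndepFun u P) {x : Fin d → U → ℝ} {z : U → ℝ} (hx : ∀ i, Measurable (x i))
    (hz : Measurable z) (hxM : ∀ i v, |x i v| ≤ M v) (hzM : ∀ v, |z v| ≤ M v)
    (hxx : ∀ i j, ∫ v, x i v * x j v ∂p = if i = j then 1 else 0)
    (hxz : ∀ i, ∫ v, x i v * z v ∂p = 0) :
    ∃ C, ∀ N : ℕ, 1 ≤ N → ∀ q : Ω → ℝ, Integrable q P →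
      (∀ᵐ ω ∂P, ∃ v, empGram x (fun n : Fin N => u n ω) *ᵥ v
          = empCorr x z (fun n : Fin N => u n ω)
        ∧ q ω = empCorr x z (fun n : Fin N => u n ω) ⬝ᵥ v) →
      |∫ ω, q ω ∂P - (N : ℝ)⁻¹ * ∫ v, (∑ i, x i v ^ 2) * z v ^ 2 ∂p|
        ≤ C * (√(N : ℝ))⁻¹ ^ 3 := by
  set m := ∫ v, M v ^ 5 ∂p with hm
  set σ := ∫ v, z v ^ 2 ∂p with hσ
  have hσ0 : 0 ≤ σ := integral_nonneg fun v => sq_nonneg _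
  have mxz : ∀ i, Measurable fun v => x i v * z v := fun i => (hx i).mul hz
  have mxx : ∀ i j, Measurable fun v => x i v * x j v := fun i j => (hx i).mul (hx j)
  have mzz : Measurable fun v => z v ^ 2 := hz.pow_const 2
  have bxz : ∀ i v, |x i v * z v| ≤ M v ^ 2 := fun i v => by
    rw [abs_mul, pow_two]
    exact mul_le_mul (hxM i v) (hzM v) (abs_nonneg _) (hM.pos v).le
  have bxx : ∀ i j v, |x i v * x j v| ≤ M v ^ 2 := fun i j v => by
    rw [abs_mul, pow_two]
    exact mul_le_mul (hxM i v) (hxM j v) (abs_nonneg _) (hM.pos v).le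
  have bzz : ∀ v, |z v ^ 2| ≤ M v ^ 2 := fun v => by
    rw [abs_pow]
    exact pow_le_pow_left₀ (abs_nonneg _) (hzM v) 2
  set C4 := 160 * m ^ 4 with hC4
  refine ⟨((16 * σ + 33) * (d * (d * C4) + d * d * (d * (d * C4)) + C4) + (σ + 3) * m + m)
    + d * (2 * m ^ 2) + d * (d * (12 * m ^ 3)), fun N hN q hq hqv => ?_⟩
  set t := (√(N : ℝ))⁻¹ with ht
  have hs := one_le_sqrt_natCast hN
  have ht0 : 0 < t := by positivity
  have ht1 : t ≤ 1 := inv_le_one_of_one_le₀ hs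
  have hNi : (N : ℝ)⁻¹ = t ^ 2 := natCast_inv_eq N
  have hNN : (t ^ 2) * N = 1 := by rw [← hNi]; exact inv_mul_cancel₀ (by positivity)
  have dxz := fun i => hM.bdd_truncDev hu (mxz i) (bxz i) N
  have dxx := fun i j => hM.bdd_truncDev hu (mxx i j) (bxx i j) N
  have dzz := hM.bdd_truncDev hu mzz bzz N
  have c : ∀ a : ℝ, BddAEMeasurable (fun _ : Ω => a) P := BddAEMeasurable.const
  have sxz := BddAEMeasurable.sum Finset.univ fun i => (dxz i).pow 4
  have sxx := BddAEMeasurable.sum Finset.univ fun i =>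
    BddAEMeasurable.sum Finset.univ fun j => (dxx i j).pow 4
  have hquartic : BddAEMeasurable (truncQuartic p M u x z N) P :=
    (((c d).mul sxz).add ((c (d * d)).mul sxx)).add (dzz.pow 4)
  have hquartic_le : ∫ ω, truncQuartic p M u x z N ω ∂P
      ≤ (d * (d * C4) + d * d * (d * (d * C4)) + C4) * t ^ 3 := by
    have e : ∫ ω, truncQuartic p M u x z N ω ∂P
        = d * ∑ i, ∫ ω, truncDev p M u (fun v => x i v * z v) N ω ^ 4 ∂P
          + d * d * ∑ i, ∑ j, ∫ ω, truncDev p M u (fun v => x i v * x j v) N ω ^ 4 ∂P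
          + ∫ ω, truncDev p M u (fun v => z v ^ 2) N ω ^ 4 ∂P := by
      simp only [truncQuartic]
      rw [integral_add (((c d).mul sxz).add ((c (d * d)).mul sxx)).integrable (dzz.pow 4).integrable,
        integral_add ((c d).mul sxz).integrable ((c (d * d)).mul sxx).integrable,
        integral_const_mul, integral_const_mul,
        integral_finsetSum _ fun i _ => ((dxz i).pow 4).integrable,
        integral_finsetSum _ fun i _ =>
          (BddAEMeasurable.sum Finset.univ fun j => (dxx i j).pow 4).integrable]
      congr 3
      exact Finset.sum_congr rfl fun i _ =>
        integral_finsetSum _ fun j _ => ((dxx i j).pow 4).integrable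
    rw [e]
    have h1 : ∑ i, ∫ ω, truncDev p M u (fun v => x i v * z v) N ω ^ 4 ∂P ≤ d * (C4 * t ^ 3) := by
      refine (Finset.sum_le_sum fun i _ =>
        hM.integral_truncDev_pow_four_le hu hind (mxz i) (bxz i) hN).trans_eq ?_
      simp [hC4, ht, hm]
    have h2 : ∑ i, ∑ j, ∫ ω, truncDev p M u (fun v => x i v * x j v) N ω ^ 4 ∂P
        ≤ d * (d * (C4 * t ^ 3)) := by
      refine (Finset.sum_le_sum fun i _ => Finset.sum_le_sum fun j _ =>
        hM.integral_truncDev_pow_four_le hu hind (mxx i j) (bxx i j) hN).trans_eq ?_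
      simp [hC4, ht, hm]
    have h3 := hM.integral_truncDev_pow_four_le hu hind mzz bzz hN
    have h1' := mul_le_mul_of_nonneg_left h1 (Nat.cast_nonneg (α := ℝ) d)
    have h2' := mul_le_mul_of_nonneg_left h2 (by positivity : (0 : ℝ) ≤ d * d)
    linarith
  have hquad : BddAEMeasurable (truncQuadratic p M u x z N) P := by
    refine (BddAEMeasurable.sum Finset.univ fun i => (dxz i).mul (dxz i)).sub
      (BddAEMeasurable.sum Finset.univ fun i => (dxz i).mul
        (BddAEMeasurable.sum Finset.univ fun j => (dxx i j).mul (dxz j)))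
  have hquad_eq : ∫ ω, truncQuadratic p M u x z N ω ∂P
      = ∑ i, ∫ ω, truncDev p M u (fun v => x i v * z v) N ω ^ 2 ∂P
        - ∑ i, ∑ j, ∫ ω, truncDev p M u (fun v => x i v * z v) N ω
          * truncDev p M u (fun v => x i v * x j v) N ω
          * truncDev p M u (fun v => x j v * z v) N ω ∂P := by
    have e : ∀ ω, truncQuadratic p M u x z N ω
        = ∑ i, truncDev p M u (fun v => x i v * z v) N ω ^ 2
        - ∑ i, ∑ j, truncDev p M u (fun v => x i v * z v) N ω
          * truncDev p M u (fun v => x i v * x j v) N ω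
          * truncDev p M u (fun v => x j v * z v) N ω := fun ω => by
      simp only [truncQuadratic, dotProduct, Matrix.mulVec, truncCorr, truncGram, Matrix.of_apply,
        Finset.mul_sum, pow_two, mul_assoc]
    have i3 := fun i j => ((dxz i).mul (dxx i j)).mul (dxz j)
    simp_rw [e]
    rw [integral_sub (BddAEMeasurable.sum Finset.univ fun i => (dxz i).pow 2).integrable
      (BddAEMeasurable.sum Finset.univ fun i =>
        BddAEMeasurable.sum Finset.univ fun j => i3 i j).integrable,
      integral_finsetSum _ fun i _ => ((dxz i).pow 2).integrable,
      integral_finsetSum _ fun i _ =>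
        (BddAEMeasurable.sum Finset.univ fun j => i3 i j).integrable]
    congr 1
    exact Finset.sum_congr rfl fun i _ => integral_finsetSum _ fun j _ => (i3 i j).integrable
  have htarget : ∫ v, (∑ i, x i v ^ 2) * z v ^ 2 ∂p = ∑ i, ∫ v, (x i v * z v) ^ 2 ∂p := by
    simp_rw [Finset.sum_mul, ← mul_pow]
    exact integral_finsetSum _ fun i _ => hM.integrable_of_le (k := 4)
      ((mxz i).pow_const 2).aestronglyMeasurable (by norm_num) (abs_sq_le_pow_four (bxz i))
  have hquad_close : |∫ ω, truncQuadratic p M u x z N ω ∂P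
      - (N : ℝ)⁻¹ * ∫ v, (∑ i, x i v ^ 2) * z v ^ 2 ∂p|
      ≤ (d * (2 * m ^ 2) + d * (d * (12 * m ^ 3))) * t ^ 3 := by
    rw [hquad_eq, htarget, Finset.mul_sum, sub_right_comm, ← Finset.sum_sub_distrib]
    refine (abs_sub _ _).trans ?_
    rw [add_mul]
    refine add_le_add ?_ ?_
    · refine (Finset.abs_sum_le_sum_abs _ _).trans ((Finset.sum_le_sum fun i _ =>
        hM.abs_integral_truncDev_sq_sub_le hu hind (mxz i) (bxz i) (hxz i) hN).trans_eq ?_)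
      simp [ht, hm, mul_assoc]
    · refine (Finset.abs_sum_le_sum_abs _ _).trans ((Finset.sum_le_sum fun i _ =>
        (Finset.abs_sum_le_sum_abs _ _).trans (Finset.sum_le_sum fun j _ =>
          hM.abs_integral_truncDev_mul_mul_le hu hind (f := ![fun v => x i v * z v,
            fun v => x i v * x j v, fun v => x j v * z v]) ?_ ?_ hN)).trans_eq ?_)
      · intro k; fin_cases k
        exacts [mxz i, mxx i j, mxz j]
      · intro k; fin_cases k
        exacts [bxz i, bxx i j, bxz j]
      · simp [ht, hm, mul_assoc]
  have bone : ∀ v, |(1 : ℝ)| ≤ M v ^ 0 := fun v => by simp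
  have ibad : Integrable (fun v => 1 - trunc M √N (fun _ => (1 : ℝ)) v) p :=
    (integrable_const _).sub (hM.bdd_trunc measurable_const bone).integrable
  have ibadz : Integrable (fun v => z v ^ 2 - trunc M √N (fun v => z v ^ 2) v) p :=
    (hM.integrable_of_le mzz.aestronglyMeasurable (by norm_num) bzz).sub
      (hM.bdd_trunc mzz bzz).integrable
  -- The expected number of truncated samples: `N` times a tail probability of order `t ^ 5`.
  have hbad : ∫ ω, sampleSum u (fun v => 1 - trunc M √N (fun _ => 1) v) N ω ∂P ≤ m * t ^ 3 := by
    rw [integral_sampleSum hu ibad]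
    have h1 := (le_abs_self _).trans (abs_integral_le_integral_abs.trans
      (hM.integral_abs_sub_trunc_le hs (f := fun _ => 1) (k := 0) (by norm_num) bone))
    calc _ ≤ (N : ℝ) * (t ^ (5 - 0) * m) := mul_le_mul_of_nonneg_left h1 (Nat.cast_nonneg N)
      _ = m * t ^ 3 := by linear_combination m * t ^ 3 * hNN
  have hbadz : (N : ℝ)⁻¹ * ∫ ω, sampleSum u
      (fun v => z v ^ 2 - trunc M √N (fun v => z v ^ 2) v) N ω ∂P ≤ m * t ^ 3 := by
    rw [integral_sampleSum hu ibadz, inv_mul_cancel_left₀ (by positivity)]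
    have h1 := (le_abs_self _).trans (abs_integral_le_integral_abs.trans
      (hM.integral_abs_sub_trunc_le hs (f := fun v => z v ^ 2) (k := 2) (by norm_num) bzz))
    exact h1.trans_eq (mul_comm _ _)
  have i1 := hquartic.integrable.const_mul (16 * σ + 33)
  have i2 := (integrable_sampleSum hu ibad N).const_mul (σ + 3)
  have i3 := (integrable_sampleSum hu ibadz N).const_mul (N : ℝ)⁻¹
  have i12 : Integrable (fun ω => (16 * σ + 33) * truncQuartic p M u x z N ω
      + (σ + 3) * sampleSum u (fun v => 1 - trunc M √N (fun _ => 1) v) N ω) P := i1.add i2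
  have herr : |∫ ω, q ω ∂P - ∫ ω, truncQuadratic p M u x z N ω ∂P|
      ≤ ((16 * σ + 33) * (d * (d * C4) + d * d * (d * (d * C4)) + C4) + (σ + 3) * m + m)
        * t ^ 3 := by
    rw [← integral_sub hq hquad.integrable]
    calc _ ≤ ∫ ω, |q ω - truncQuadratic p M u x z N ω| ∂P := abs_integral_le_integral_abs
      _ ≤ ∫ ω, ((16 * σ + 33) * truncQuartic p M u x z N ω
          + (σ + 3) * sampleSum u (fun v => 1 - trunc M √N (fun _ => 1) v) N ω
          + (N : ℝ)⁻¹ * sampleSum u (fun v => z v ^ 2 - trunc M √N (fun v => z v ^ 2) v) N ω) ∂P := by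
          refine integral_mono_ae (hq.sub hquad.integrable).abs (i12.add i3) ?_
          filter_upwards [hqv] with ω hω
          obtain ⟨v, hv, hqω⟩ := hω
          rw [hqω]
          exact abs_empCorr_dotProduct_sub_truncQuadratic_le hxx hxz hv
      _ = (16 * σ + 33) * ∫ ω, truncQuartic p M u x z N ω ∂P
          + (σ + 3) * ∫ ω, sampleSum u (fun v => 1 - trunc M √N (fun _ => 1) v) N ω ∂P
          + (N : ℝ)⁻¹ * ∫ ω, sampleSum u
            (fun v => z v ^ 2 - trunc M √N (fun v => z v ^ 2) v) N ω ∂P := by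
          rw [integral_add i12 i3, integral_add i1 i2, integral_const_mul,
            integral_const_mul, integral_const_mul]
      _ ≤ _ := by
          have h1 := mul_le_mul_of_nonneg_left hquartic_le (by positivity : 0 ≤ 16 * σ + 33)
          have h2 := mul_le_mul_of_nonneg_left hbad (by positivity : 0 ≤ σ + 3)
          linarith
  have := (abs_sub_le _ _ _).trans (add_le_add herr hquad_close)
  linarith

end OrthonormalReadouts

/-! ## Orthonormal coordinates for the readouts -/

section Decomposition

variable {U : Type*} [MeasurableSpace U] {p : Measure U} {K d : ℕ}

/-- Orthonormal functions `x` with the same span as the readouts `X`, together with the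
decomposition of `y` into a combination of the `x j` and a residual `z` orthogonal to them. -/
structure IsOrthonormalDecomposition (p : Measure U) (X : Fin K → U → ℝ) (y : U → ℝ)
    (x : Fin d → U → ℝ) (z : U → ℝ) (A : Fin K → Fin d → ℝ) (B : Fin d → Fin K → ℝ)
    (c : Fin d → ℝ) : Prop where
  measurable_basis : ∀ j, Measurable (x j)
  measurable_residual : Measurable z
  memLp_basis : ∀ j, MemLp (x j) 5 p
  memLp_residual : MemLp z 5 p
  integral_mul : ∀ i j, ∫ v, x i v * x j v ∂p = if i = j then 1 else 0
  integral_mul_residual : ∀ i, ∫ v, x i v * z v ∂p = 0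
  readout_ae : ∀ i, ∀ᵐ v ∂p, X i v = ∑ j, A i j * x j v
  basis_ae : ∀ j, ∀ᵐ v ∂p, x j v = ∑ i, B j i * X i v
  target_ae : ∀ᵐ v ∂p, y v = ∑ j, c j * x j v + z v

theorem coeFn_sum_smul_ae {κ : Type*} [Fintype κ] (a : κ → ℝ) (f : κ → Lp ℝ 2 p) :
    ∀ᵐ v ∂p, (∑ k, a k • f k : Lp ℝ 2 p) v = ∑ k, a k * f k v := by
  have h : ∀ᵐ v ∂p, ∀ k, (a k • f k : Lp ℝ 2 p) v = a k * f k v :=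
    ae_all_iff.2 fun k => Lp.coeFn_smul (a k) (f k)
  filter_upwards [Lp.coeFn_fun_finsetSum Finset.univ fun k => a k • f k, h] with v h1 h2
  rw [h1]
  exact Finset.sum_congr rfl fun k _ => h2 k

theorem memLp_sum_mul {κ : Type*} [Fintype κ] (a : κ → ℝ) {f : κ → U → ℝ} {q : ENNReal}
    (hf : ∀ k, MemLp (f k) q p) : MemLp (fun v => ∑ k, a k * f k v) q p :=
  memLp_finsetSum _ fun k _ => (hf k).const_mul (a k)

theorem integral_coeFn_mul (f g : Lp ℝ 2 p) : ∫ v, f v * g v ∂p = inner ℝ f g := by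
  rw [L2.inner_def]
  exact integral_congr_ae (Eventually.of_forall fun v => by simp [mul_comm])

/-- The basis vectors are finite linear combinations of the readouts, and the residual is `y` minus
such a combination, so both inherit fifth moments even though they are built in `L²`. -/
theorem exists_isOrthonormalDecomposition {X : Fin K → U → ℝ} {y : U → ℝ}
    (hX : ∀ i, MemLp (X i) 2 p) (hy : MemLp y 2 p)
    (hX5 : ∀ i, MemLp (X i) 5 p) (hy5 : MemLp y 5 p)
    (Xt : OrthonormalBasis (Fin d) ℝ (readoutSpace p X hX)) :
    ∃ A B c, IsOrthonormalDecomposition p X y (fun j => ((Xt j : Lp ℝ 2 p) : U → ℝ))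
      (orthComponent p X y hX hy) A B c := by
  have hcomb : ∀ f ∈ readoutSpace p X hX, ∃ a : Fin d → ℝ, f = ∑ j, a j • (Xt j : Lp ℝ 2 p) := fun f hf => by
    refine ⟨fun j => Xt.repr ⟨f, hf⟩ j, ?_⟩
    have := congrArg (Subtype.val) (Xt.sum_repr ⟨f, hf⟩)
    simpa using this.symm
  have hA : ∀ i, ∃ a : Fin d → ℝ, ∀ᵐ v ∂p, X i v = ∑ j, a j * (Xt j : Lp ℝ 2 p) v := fun i => by
    obtain ⟨a, ha⟩ := hcomb _ (Submodule.subset_span (Set.mem_range_self i) :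
      (hX i).toLp (X i) ∈ readoutSpace p X hX)
    refine ⟨a, ?_⟩
    filter_upwards [(hX i).coeFn_toLp, coeFn_sum_smul_ae a fun j => (Xt j : Lp ℝ 2 p)] with v h1 h2
    rw [← h1, ha, h2]
  have hB : ∀ j, ∃ b : Fin K → ℝ, ∀ᵐ v ∂p, (Xt j : Lp ℝ 2 p) v = ∑ i, b i * X i v := fun j => by
    obtain ⟨b, hb⟩ := (Submodule.mem_span_range_iff_exists_fun ℝ).1 (Xt j).2
    refine ⟨b, ?_⟩
    have h : ∀ᵐ v ∂p, ∀ i, ((hX i).toLp (X i) : U → ℝ) v = X i v :=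
      ae_all_iff.2 fun i => (hX i).coeFn_toLp
    filter_upwards [h, coeFn_sum_smul_ae b fun i => (hX i).toLp (X i)] with v h1 h2
    rw [← hb, h2]
    exact Finset.sum_congr rfl fun i _ => by rw [h1]
  have hc : ∃ c : Fin d → ℝ, ∀ᵐ v ∂p, y v
      = ∑ j, c j * (Xt j : Lp ℝ 2 p) v + orthComponent p X y hX hy v := by
    obtain ⟨c, hc⟩ := hcomb _ ((readoutSpace p X hX).starProjection_apply_mem (hy.toLp y))
    have hsum : hy.toLp y = ∑ j, c j • (Xt j : Lp ℝ 2 p) + orthComponent p X y hX hy := by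
      rw [← hc]
      exact ((readoutSpace p X hX).starProjection_add_starProjection_orthogonal (hy.toLp y)).symm
    refine ⟨c, ?_⟩
    filter_upwards [hy.coeFn_toLp, coeFn_sum_smul_ae c fun j => (Xt j : Lp ℝ 2 p),
      Lp.coeFn_add (∑ j, c j • (Xt j : Lp ℝ 2 p)) (orthComponent p X y hX hy)] with v h1 h2 h3
    rw [← h1, hsum, h3, Pi.add_apply, h2]
  choose A hA using hA
  choose B hB using hB
  obtain ⟨c, hc⟩ := hc
  have hx5 : ∀ j, MemLp ((Xt j : Lp ℝ 2 p) : U → ℝ) 5 p := fun j =>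
    (memLp_sum_mul (B j) hX5).ae_eq (by filter_upwards [hB j] with v hv using hv.symm)
  refine ⟨A, B, c, fun j => (Lp.stronglyMeasurable _).measurable,
    (Lp.stronglyMeasurable _).measurable, hx5, ?_, fun i j => ?_, fun i => ?_, hA, hB, hc⟩
  · refine (hy5.sub (memLp_sum_mul c hx5)).ae_eq ?_
    filter_upwards [hc] with v hv
    simp [hv]
  · rw [integral_coeFn_mul, ← Submodule.coe_inner]
    exact orthonormal_iff_ite.1 Xt.orthonormal i j
  · rw [integral_coeFn_mul]
    exact Submodule.inner_right_of_mem_orthogonal (Xt i).2 (Submodule.starProjection_apply_mem _ _)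

namespace IsOrthonormalDecomposition

variable {X : Fin K → U → ℝ} {y : U → ℝ} {x : Fin d → U → ℝ} {z : U → ℝ}
  {A : Fin K → Fin d → ℝ} {B : Fin d → Fin K → ℝ} {c : Fin d → ℝ}

theorem exists_isEnvelope [IsProbabilityMeasure p] (h : IsOrthonormalDecomposition p X y x z A B c) :
    ∃ M, IsEnvelope M p ∧ (∀ i v, |x i v| ≤ M v) ∧ ∀ v, |z v| ≤ M v := by
  have hsum : ∀ v, 0 ≤ ∑ i, |x i v| := fun v => Finset.sum_nonneg fun i _ => abs_nonneg _
  refine ⟨fun v => 1 + ∑ i, |x i v| + |z v|, ⟨?_, fun v => ?_, ?_⟩, fun i v => ?_, fun v => ?_⟩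
  · have := h.measurable_basis
    have := h.measurable_residual
    fun_prop
  · linarith [hsum v, abs_nonneg (z v)]
  · have h1 : MemLp (fun v => ∑ i, |x i v|) 5 p :=
      memLp_finsetSum _ fun i _ => (h.memLp_basis i).abs
    have h2 : MemLp (fun v => 1 + ∑ i, |x i v| + |z v|) 5 p :=
      ((memLp_const (1 : ℝ)).add h1).add h.memLp_residual.abs
    have h3 : MemLp (fun v => 1 + ∑ i, |x i v| + |z v|) ((5 : ℕ) : ENNReal) p := by
      exact_mod_cast h2
    refine (h3.integrable_norm_pow (by norm_num)).congr (Eventually.of_forall fun v => ?_)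
    simp only
    rw [Real.norm_of_nonneg]
    linarith [hsum v, abs_nonneg (z v)]
  · have := Finset.single_le_sum (f := fun i => |x i v|) (fun i _ => abs_nonneg _)
      (Finset.mem_univ i)
    linarith [abs_nonneg (z v)]
  · linarith [hsum v]

variable [IsProbabilityMeasure p]

theorem memLp_two_basis (h : IsOrthonormalDecomposition p X y x z A B c) (j : Fin d) :
    MemLp (x j) 2 p := (h.memLp_basis j).mono_exponent (by norm_num)

theorem memLp_two_residual (h : IsOrthonormalDecomposition p X y x z A B c) :
    MemLp z 2 p := h.memLp_residual.mono_exponent (by norm_num)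

/-- Pythagoras. The sign `b` allows one identity to serve both the target (`b = 1`) and the
prediction error (`b = -1`). -/
theorem integral_sum_add_sq (h : IsOrthonormalDecomposition p X y x z A B c) (a : Fin d → ℝ)
    (b : ℝ) : ∫ v, (∑ j, a j * x j v + b * z v) ^ 2 ∂p = ∑ j, a j ^ 2 + b ^ 2 * ∫ v, z v ^ 2 ∂p := by
  have hxx : ∀ i j, Integrable (fun v => a i * a j * (x i v * x j v)) p := fun i j =>
    ((h.memLp_two_basis i).integrable_mul (h.memLp_two_basis j)).const_mul _
  have hxz : ∀ i, Integrable (fun v => 2 * b * a i * (x i v * z v)) p := fun i =>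
    ((h.memLp_two_basis i).integrable_mul h.memLp_two_residual).const_mul _
  have hzz : Integrable (fun v => b ^ 2 * z v ^ 2) p :=
    h.memLp_two_residual.integrable_sq.const_mul _
  have hexp : ∀ v, (∑ j, a j * x j v + b * z v) ^ 2 = ∑ i, ∑ j, a i * a j * (x i v * x j v)
      + (∑ i, 2 * b * a i * (x i v * z v) + b ^ 2 * z v ^ 2) := fun v => by
    have e1 : (∑ j, a j * x j v) ^ 2 = ∑ i, ∑ j, a i * a j * (x i v * x j v) := by
      rw [pow_two, Finset.sum_mul_sum]
      exact Finset.sum_congr rfl fun i _ => Finset.sum_congr rfl fun j _ => by ring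
    have e2 : 2 * (∑ j, a j * x j v) * (b * z v) = ∑ i, 2 * b * a i * (x i v * z v) := by
      rw [Finset.mul_sum, Finset.sum_mul]
      exact Finset.sum_congr rfl fun i _ => by ring
    rw [add_sq, e1, e2]
    ring
  simp_rw [hexp]
  have i1 : Integrable (fun v => ∑ i, ∑ j, a i * a j * (x i v * x j v)) p :=
    integrable_finsetSum _ fun i _ => integrable_finsetSum _ fun j _ => hxx i j
  have i2 : Integrable (fun v => ∑ i, 2 * b * a i * (x i v * z v)) p :=
    integrable_finsetSum _ fun i _ => hxz i
  have i3 : Integrable (fun v => ∑ i, 2 * b * a i * (x i v * z v) + b ^ 2 * z v ^ 2) p :=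
    i2.add hzz
  rw [integral_add i1 i3, integral_add i2 hzz,
    integral_finsetSum _ fun i _ => integrable_finsetSum _ fun j _ => hxx i j,
    integral_finsetSum _ fun i _ => hxz i, integral_const_mul]
  simp_rw [integral_finsetSum _ fun j _ => hxx _ j, integral_const_mul, h.integral_mul,
    h.integral_mul_residual]
  simp [pow_two]

theorem integral_target_sq (h : IsOrthonormalDecomposition p X y x z A B c) :
    ∫ v, y v ^ 2 ∂p = ∑ j, c j ^ 2 + ∫ v, z v ^ 2 ∂p := by
  have := h.integral_sum_add_sq c 1
  simp only [one_mul, one_pow] at this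
  rw [← this]
  refine integral_congr_ae ?_
  filter_upwards [h.target_ae] with v hv
  rw [hv]

theorem iInf_mse (h : IsOrthonormalDecomposition p X y x z A B c) :
    ⨅ W : Fin K → ℝ, mse p X y W = ∫ v, z v ^ 2 ∂p := by
  have hX := ae_all_iff.2 h.readout_ae
  have hx := ae_all_iff.2 h.basis_ae
  refine le_antisymm ?_ (le_ciInf fun W => ?_)
  -- These weights reproduce the projection `c·x` of `y`, so the error is exactly `z`.
  · refine (ciInf_le ⟨0, ?_⟩ fun i => ∑ j, c j * B j i).trans_eq ?_
    · rintro _ ⟨W, rfl⟩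
      exact integral_nonneg fun v => sq_nonneg _
    · refine integral_congr_ae ?_
      filter_upwards [hx, h.target_ae] with v h1 h2
      have : ∑ i, (∑ j, c j * B j i) * X i v = ∑ j, c j * x j v := by
        simp only [h1, Finset.mul_sum, Finset.sum_mul]
        rw [Finset.sum_comm]
        exact Finset.sum_congr rfl fun i _ => Finset.sum_congr rfl fun j _ => by ring
      rw [this, h2]
      ring
  · have : mse p X y W = ∫ v, (∑ j, (∑ i, W i * A i j - c j) * x j v + (-1) * z v) ^ 2 ∂p := by
      refine integral_congr_ae ?_
      filter_upwards [hX, h.target_ae] with v h1 h2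
      have : ∑ i, W i * X i v = ∑ j, (∑ i, W i * A i j) * x j v := by
        simp only [h1, Finset.mul_sum, Finset.sum_mul]
        rw [Finset.sum_comm]
        exact Finset.sum_congr rfl fun i _ => Finset.sum_congr rfl fun j _ => by ring
      rw [this, h2]
      simp only [sub_mul, Finset.sum_sub_distrib]
      ring
    rw [this, h.integral_sum_add_sq]
    have : 0 ≤ ∑ j, (∑ i, W i * A i j - c j) ^ 2 := Finset.sum_nonneg fun j _ => sq_nonneg _
    linarith

theorem capacity_eq (h : IsOrthonormalDecomposition p X y x z A B c)
    (hy0 : 0 < ∫ v, y v ^ 2 ∂p) :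
    capacity p X y = (∑ j, c j ^ 2) / ∫ v, y v ^ 2 ∂p := by
  rw [capacity, h.iInf_mse, eq_div_iff hy0.ne', sub_mul, one_mul, div_mul_cancel₀ _ hy0.ne']
  linarith [h.integral_target_sq]

end IsOrthonormalDecomposition

end Decomposition

/-! ## Expectation of the empirical capacity -/

section EmpiricalCapacity

variable {U Ω : Type*} [MeasurableSpace U] [MeasurableSpace Ω]
  {p : Measure U} {P : Measure Ω} {u : ℕ → Ω → U} {K d : ℕ}

theorem ae_forall_comp_of_ae (hu : ∀ n, HasLaw (u n) p P) {q : U → Prop} (hq : ∀ᵐ v ∂p, q v) :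
    ∀ᵐ ω ∂P, ∀ n, q (u n ω) :=
  ae_all_iff.2 fun n => ae_of_ae_map (hu n).aemeasurable ((hu n).map_eq ▸ hq)

theorem aemeasurable_empCorr_dotProduct_pinv {X : Fin K → U → ℝ} {y : U → ℝ}
    (hX : ∀ i, AEMeasurable (X i) p) (hy : AEMeasurable y p) (hu : ∀ n, HasLaw (u n) p P) (N : ℕ) :
    AEMeasurable (fun ω => empCorr X y (fun n : Fin N => u n ω)
      ⬝ᵥ (pinv (empGram X fun n : Fin N => u n ω) *ᵥ empCorr X y fun n : Fin N => u n ω)) P := by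
  have hXu : ∀ i (n : ℕ), AEMeasurable (fun ω => X i (u n ω)) P := fun i n =>
    ((hu n).map_eq ▸ hX i).comp_aemeasurable (hu n).aemeasurable
  have hyu : ∀ n : ℕ, AEMeasurable (fun ω => y (u n ω)) P := fun n =>
    ((hu n).map_eq ▸ hy).comp_aemeasurable (hu n).aemeasurable
  refine AEMeasurable.isLUB (ι := Fin K → ℚ) (f := fun w ω =>
    2 * (empCorr X y (fun n : Fin N => u n ω) ⬝ᵥ fun i => (w i : ℝ))
      - (fun i => (w i : ℝ)) ⬝ᵥ (empGram X (fun n : Fin N => u n ω) *ᵥ fun i => (w i : ℝ)))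
    (fun w => ?_) (Eventually.of_forall fun ω => isLUB_empCorr_dotProduct (empGram_mulVec_pinv X y _))
  simp only [dotProduct, Matrix.mulVec, empCorr, empGram, Matrix.of_apply]
  refine ((Finset.aemeasurable_fun_sum _ fun i _ => ?_).const_mul 2).sub
    (Finset.aemeasurable_fun_sum _ fun i _ =>
      (Finset.aemeasurable_fun_sum _ fun j _ => ?_).const_mul _)
  · exact ((Finset.aemeasurable_fun_sum _ fun (n : Fin N) _ =>
      (hXu i n).fun_mul (hyu n)).const_mul _).mul_const _
  · exact ((Finset.aemeasurable_fun_sum _ fun (n : Fin N) _ =>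
      (hXu i n).fun_mul (hXu j n)).const_mul _).mul_const _

theorem integrable_empCorr_dotProduct_pinv {X : Fin K → U → ℝ} {y : U → ℝ}
    (hX : ∀ i, AEMeasurable (X i) p) (hy : MemLp y 2 p) (hu : ∀ n, HasLaw (u n) p P) (N : ℕ) :
    Integrable (fun ω => empCorr X y (fun n : Fin N => u n ω)
      ⬝ᵥ (pinv (empGram X fun n : Fin N => u n ω) *ᵥ empCorr X y fun n : Fin N => u n ω)) P := by
  refine Integrable.mono' ((integrable_sampleSum hu hy.integrable_sq N).const_mul (N : ℝ)⁻¹)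
    (aemeasurable_empCorr_dotProduct_pinv hX hy.aemeasurable hu N).aestronglyMeasurable
    (Eventually.of_forall fun ω => ?_)
  have hv := empGram_mulVec_pinv X y fun n : Fin N => u n ω
  rw [Real.norm_of_nonneg (empCorr_dotProduct_nonneg hv), sampleSum,
    ← Fin.sum_univ_eq_sum_range (fun n => y (u n ω) ^ 2) N]
  exact empCorr_dotProduct_le hv

theorem exists_abs_integral_empCapacity_sub_le [IsProbabilityMeasure p] [IsProbabilityMeasure P]
    {X : Fin K → U → ℝ} {y : U → ℝ} {x : Fin d → U → ℝ} {z : U → ℝ} {A : Fin K → Fin d → ℝ}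
    {B : Fin d → Fin K → ℝ} {c : Fin d → ℝ} (h : IsOrthonormalDecomposition p X y x z A B c)
    (hX : ∀ i, AEMeasurable (X i) p) (hy : MemLp y 2 p) (hy0 : 0 < ∫ v, y v ^ 2 ∂p)
    (hu : ∀ n, HasLaw (u n) p P) (hind : iIndepFun u P) :
    ∃ C, ∀ N : ℕ, 1 ≤ N →
      |∫ ω, empCapacity p X y (fun n : Fin N => u n ω) ∂P - (capacity p X y
        + (∫ v, (∑ i, x i v ^ 2) * z v ^ 2 ∂p) / (∫ v, y v ^ 2 ∂p) / N)|
        ≤ C * (√(N : ℝ))⁻¹ ^ 3 := by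
  obtain ⟨M, hM, hxM, hzM⟩ := h.exists_isEnvelope
  obtain ⟨C, hC⟩ := exists_abs_integral_sub_le hM hu hind h.measurable_basis h.measurable_residual
    hxM hzM h.integral_mul h.integral_mul_residual
  set D := ∫ v, y v ^ 2 ∂p with hD
  refine ⟨C / D, fun N hN => ?_⟩
  set fit : Ω → ℝ := fun ω => empCorr X y (fun n : Fin N => u n ω)
      ⬝ᵥ (pinv (empGram X fun n : Fin N => u n ω) *ᵥ empCorr X y fun n : Fin N => u n ω) with hfit
  -- This is `(c·x)² + 2 (c·x) z`, written so that its mean follows from `integral_sum_add_sq`. Its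
  -- sample mean is unbiased, so subtracting it from the fit leaves only the fit of `z`.
  set g : U → ℝ := fun v => (∑ j, c j * x j v + 1 * z v) ^ 2 - z v ^ 2 with hg
  have hxc : MemLp (fun v => ∑ j, c j * x j v + 1 * z v) 2 p :=
    (memLp_sum_mul c h.memLp_two_basis).add (h.memLp_two_residual.const_mul 1)
  have hgi : Integrable g p := hxc.integrable_sq.sub h.memLp_two_residual.integrable_sq
  have hgint : ∫ v, g v ∂p = ∑ j, c j ^ 2 := by
    rw [hg, integral_sub hxc.integrable_sq h.memLp_two_residual.integrable_sq,
      h.integral_sum_add_sq]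
    ring
  have hfiti : Integrable fit P := integrable_empCorr_dotProduct_pinv hX hy hu N
  have hmean := (integrable_sampleSum hu hgi N).const_mul (N : ℝ)⁻¹
  have hmean_eq : ∫ ω, (N : ℝ)⁻¹ * sampleSum u g N ω ∂P = ∑ j, c j ^ 2 := by
    rw [integral_const_mul, integral_sampleSum hu hgi, hgint, inv_mul_cancel_left₀ (by positivity)]
  have hbound := hC N hN (fun ω => fit ω - (N : ℝ)⁻¹ * sampleSum u g N ω) (hfiti.sub hmean) (by
    filter_upwards [ae_forall_comp_of_ae hu (ae_all_iff.2 h.readout_ae),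
      ae_forall_comp_of_ae hu (ae_all_iff.2 h.basis_ae), ae_forall_comp_of_ae hu h.target_ae]
      with ω h1 h2 h3
    obtain ⟨v', hv', hval⟩ := exists_empGram_mulVec_eq_of_basis_change
      (s := fun n : Fin N => u n ω) (fun i n => h1 n i) (fun j n => h2 n j) (fun n => h3 n)
      (empGram_mulVec_pinv X y _)
    refine ⟨v', hv', ?_⟩
    have : (N : ℝ)⁻¹ * sampleSum u g N ω
        = c ⬝ᵥ (empGram x (fun n : Fin N => u n ω) *ᵥ c)
          + 2 * (c ⬝ᵥ empCorr x z fun n : Fin N => u n ω) := by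
      rw [dotProduct_empGram_mulVec, dotProduct_empCorr, sampleSum,
        ← Fin.sum_univ_eq_sum_range (fun n => g (u n ω)) N, mul_left_comm, ← mul_add,
        Finset.mul_sum (a := (2 : ℝ)), ← Finset.sum_add_distrib]
      congr 1
      exact Finset.sum_congr rfl fun n _ => by rw [hg]; ring
    rw [hfit, this]
    simp only [hval]
    ring)
  rw [integral_sub hfiti hmean, hmean_eq] at hbound
  have hcap : ∫ ω, empCapacity p X y (fun n : Fin N => u n ω) ∂P = (∫ ω, fit ω ∂P) / D := by
    simp only [empCapacity, ← hD, hfit]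
    exact integral_div _ _
  have hN0 : (N : ℝ) ≠ 0 := by positivity
  rw [hcap, h.capacity_eq hy0, ← hD]
  have e : (∫ ω, fit ω ∂P) / D - ((∑ j, c j ^ 2) / D
      + (∫ v, (∑ i, x i v ^ 2) * z v ^ 2 ∂p) / D / N)
      = (∫ ω, fit ω ∂P - ∑ j, c j ^ 2
        - (N : ℝ)⁻¹ * ∫ v, (∑ i, x i v ^ 2) * z v ^ 2 ∂p) / D := by
    field_simp
    ring
  rw [e, abs_div, abs_of_pos hy0, div_mul_eq_mul_div]
  gcongr

theorem IsOrthonormalDecomposition.integrable_mul_sq [IsProbabilityMeasure p]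
    {X : Fin K → U → ℝ} {y : U → ℝ} {x : Fin d → U → ℝ} {z : U → ℝ} {A : Fin K → Fin d → ℝ}
    {B : Fin d → Fin K → ℝ} {c : Fin d → ℝ} (h : IsOrthonormalDecomposition p X y x z A B c) :
    Integrable (fun v => (∑ i, x i v ^ 2) * z v ^ 2) p := by
  obtain ⟨M, hM, hxM, hzM⟩ := h.exists_isEnvelope
  simp_rw [Finset.sum_mul, ← mul_pow]
  refine integrable_finsetSum _ fun i _ => hM.integrable_of_le (k := 4)
    (((h.measurable_basis i).mul h.measurable_residual).pow_const 2).aestronglyMeasurable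
    (by norm_num) (abs_sq_le_pow_four fun v => ?_)
  rw [abs_mul, pow_two]
  exact mul_le_mul (hxM i v) (hzM v) (abs_nonneg _) (hM.pos v).le

theorem biasIntegrand_reindex {X : Fin K → U → ℝ} {y : U → ℝ} (hX : ∀ i, MemLp (X i) 2 p)
    (hy : MemLp y 2 p) {ι κ : Type*} [Fintype ι] [Fintype κ]
    (Xt : OrthonormalBasis ι ℝ (readoutSpace p X hX)) (e : ι ≃ κ) :
    biasIntegrand p X y hX hy (Xt.reindex e) = biasIntegrand p X y hX hy Xt := by
  ext v
  simp only [biasIntegrand, OrthonormalBasis.reindex_apply]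
  rw [Equiv.sum_comp e.symm fun i => ((Xt i : Lp ℝ 2 p) : U → ℝ) v ^ 2]

theorem sqrt_inv_pow_three_eq_rpow (N : ℕ) :
    (√(N : ℝ))⁻¹ ^ 3 = (N : ℝ) ^ (-(3 / 2) : ℝ) := by
  rw [Real.rpow_neg (Nat.cast_nonneg N), inv_pow, Real.sqrt_eq_rpow, ← Real.rpow_natCast,
    ← Real.rpow_mul (Nat.cast_nonneg N)]
  norm_num

end EmpiricalCapacity

end IPC

theorem proposition7 {U : Type*} [MeasurableSpace U] (p : Measure U) [IsProbabilityMeasure p]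
    {K : ℕ} (X : Fin K → U → ℝ) (y : U → ℝ)
    (hX : ∀ i, MemLp (X i) 2 p) (hy : MemLp y 2 p) (hy0 : 0 < ∫ v, y v ^ 2 ∂p)
    (hX5 : ∀ i, MemLp (X i) 5 p) (hy5 : MemLp y 5 p)
    {ι : Type*} [Fintype ι] (Xt : OrthonormalBasis ι ℝ (IPC.readoutSpace p X hX))
    {Ω : Type*} [MeasurableSpace Ω] (P : Measure Ω) [IsProbabilityMeasure P]
    (u : ℕ → Ω → U) (hu : ∀ n, HasLaw (u n) p P) (hind : iIndepFun u P) :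
    (∀ N : ℕ, Integrable (fun ω => IPC.empCapacity p X y (fun n : Fin N => u n ω)) P) ∧
    Integrable (IPC.biasIntegrand p X y hX hy Xt) p ∧
    0 ≤ IPC.biasCoeff p X y hX hy Xt ∧
    (fun N : ℕ => (∫ ω, IPC.empCapacity p X y (fun n : Fin N => u n ω) ∂P)
        - (IPC.capacity p X y + IPC.biasCoeff p X y hX hy Xt / (N : ℝ)))
      =O[atTop] (fun N : ℕ => (N : ℝ) ^ (-(3 / 2) : ℝ)) := by
  have hXm := fun i => (hX i).aemeasurable
  -- The given basis itself serves as `x`, up to relabelling by `Fin d`, so the coefficient is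
  -- obtained directly for every orthonormal basis.
  obtain ⟨A, B, c, h⟩ := IPC.exists_isOrthonormalDecomposition hX hy hX5 hy5
    (Xt.reindex (Fintype.equivFin ι))
  have hint : Integrable (IPC.biasIntegrand p X y hX hy Xt) p := by
    rw [← IPC.biasIntegrand_reindex hX hy Xt (Fintype.equivFin ι)]
    exact h.integrable_mul_sq
  refine ⟨fun N => (IPC.integrable_empCorr_dotProduct_pinv hXm hy hu N).div_const _, hint,
    div_nonneg (integral_nonneg fun v => ?_) hy0.le, ?_⟩
  · exact mul_nonneg (Finset.sum_nonneg fun i _ => sq_nonneg _) (sq_nonneg _)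
  · obtain ⟨C, hC⟩ := IPC.exists_abs_integral_empCapacity_sub_le h hXm hy hy0 hu hind
    refine Asymptotics.IsBigO.of_bound C ?_
    filter_upwards [eventually_ge_atTop 1] with N hN
    rw [← IPC.sqrt_inv_pow_three_eq_rpow, Real.norm_eq_abs, Real.norm_of_nonneg (by positivity),
      IPC.biasCoeff, ← IPC.biasIntegrand_reindex hX hy Xt (Fintype.equivFin ι)]
    exact hC N hN
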